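/- Let $n\ge 1$ and $a,b>0$. For integrable $f:\mathbb R^n\to\mathbb C$ put $\hat f(\xi)=(2\pi)^{-n/2}\int_{\mathbb R^n} f(x)e^{-ix\cdot\xi}\,dx$, and for $z\in\mathbb C^n$ write $z^2=z_1^2+\dots+z_n^2$. Say that $f$ satisfies condition $(\ast)$ with functions $P,Q:\mathbb R^n\to\mathbb R$ if $f$ is integrable, $$|f(x)|\le P(x)e^{-\frac12 a|x|^2},\qquad |\hat f(\xi)|\le Q(\xi)e^{-\frac12 b|\xi|^2}\qquad(x,\xi\in\mathbb R^n),$$ and $$\limsup_{|x|\to\infty}\frac{\log P(x)}{|x|^2}=0=\limsup_{|\xi|\to\infty}\frac{\log Q(\xi)}{|\xi|^2}$$ (with $\log 0=-\infty$). (i) If $ab>1$ and $f$ satisfies $(\ast)$ with some $P,Q$, then $f=0$ almost everywhere. (ii) If $ab=1$ and $f$ satisfies $(\ast)$ with some $P,Q$, then $f$ (after modification on a null set) and $\hat f$ extend to entire functions on $\mathbb C^n$ of the form $$f(z)=R(z)e^{-\frac12 a z^2},\qquad \hat f(z)=S(z)e^{-\frac1{2a}z^2},$$ where $R$ and $S$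 are entire functions on $\mathbb C^n$ of order at most $2$ and at most of minimal type with respect to the order $2$; that is, $\limsup_{r\to\infty} r^{-2}\log\max_{|z|\le r}|F(z)|\le 0$ for $F=R$ and for $F=S$. (iii) If $ab<1$, there are $P,Q$ and infinitely many linearly independent continuous functions that satisfy $(\ast)$ with these $P,Q$. Moreover, for every $c>0$ with $a\le c^2\le 1/b$ and every multi-index $\alpha\in\mathbb N^n$, the dilated Hermite function $x\mapsto\Phi_\alpha(cx)$ satisfies $(\ast)$ with some $P,Q$ (depending on $\alpha$ and $c$). Here $\Phi_\alpha(x)=\prod_{j=1}^n h_{\alpha_j}(x_j)$ and $h_k(t)=(2^kk!\sqrt\pi)^{-1/2}(-1)^ke^{t^2/2}\frac{d^k}{dt^k}e^{-t^2}$. -/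

import Mathlib

open MeasureTheory Filter
open scoped ENNReal

namespace Pfannschmidt

/-- The unitary Fourier transform on `ℝⁿ`,
`f̂(ξ) = (2π)^(-n/2) ∫ f(x) exp(-i x·ξ) dx`, used for integrable `f`. -/
noncomputable def fourier {n : ℕ} (f : EuclideanSpace ℝ (Fin n) → ℂ)
    (ξ : EuclideanSpace ℝ (Fin n)) : ℂ :=
  (((2 * Real.pi) ^ (-(n : ℝ) / 2) : ℝ) : ℂ) *
    ∫ x, Complex.exp (-Complex.I * ((inner ℝ x ξ : ℝ) : ℂ)) * f x

/-- `limsup_{|x| → ∞} log P(x) / |x|²`, as an extended real number, with `log 0 = -∞`. -/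
noncomputable def logGrowth {n : ℕ} (P : EuclideanSpace ℝ (Fin n) → ℝ) : EReal :=
  limsup (fun x => ENNReal.log (ENNReal.ofReal (P x)) / ((‖x‖ ^ 2 : ℝ) : EReal))
    (Bornology.cobounded (EuclideanSpace ℝ (Fin n)))

/-- The decay condition on `f` and `f̂`.  Integrability is what gives `f̂` its meaning: the
bound by `P` controls `f` only near infinity, since `P` need not be locally bounded. -/
structure Condition {n : ℕ} (a b : ℝ) (P Q : EuclideanSpace ℝ (Fin n) → ℝ)
    (f : EuclideanSpace ℝ (Fin n) → ℂ) : Prop where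
  integrable : Integrable f
  bound : ∀ x, ‖f x‖ ≤ P x * Real.exp (-(a * ‖x‖ ^ 2 / 2))
  bound_fourier : ∀ ξ, ‖fourier f ξ‖ ≤ Q ξ * Real.exp (-(b * ‖ξ‖ ^ 2 / 2))
  logGrowth_left : logGrowth P = 0
  logGrowth_right : logGrowth Q = 0

/-- The inclusion `ℝⁿ ⊆ ℂⁿ`. -/
noncomputable def toComplex {n : ℕ} (x : EuclideanSpace ℝ (Fin n)) :
    EuclideanSpace ℂ (Fin n) :=
  WithLp.toLp 2 fun j => (x j : ℂ)

/-- `z² = z₁² + ⋯ + zₙ²` for `z ∈ ℂⁿ`. -/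
noncomputable def sq {n : ℕ} (z : EuclideanSpace ℂ (Fin n)) : ℂ := ∑ j, z j ^ 2

/-- The maximum modulus `M(r) = sup_{|z| ≤ r} |F(z)|`. -/
noncomputable def maxModulus {n : ℕ} (F : EuclideanSpace ℂ (Fin n) → ℂ) (r : ℝ) : ℝ≥0∞ :=
  ⨆ z ∈ Metric.closedBall (0 : EuclideanSpace ℂ (Fin n)) r, ‖F z‖ₑ

/-- The type of `F` with respect to the order `ρ`: `limsup_{r → ∞} log M(r) / r^ρ`. -/
noncomputable def growthType {n : ℕ} (ρ : ℝ) (F : EuclideanSpace ℂ (Fin n) → ℂ) : EReal :=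
  limsup (fun r : ℝ => ENNReal.log (maxModulus F r) / ((r ^ ρ : ℝ) : EReal)) atTop

/-- The order of `F`: the infimum of the `ρ ≥ 0` such that `log M(r) ≤ C r^ρ` for some `C`
and all large `r`. -/
noncomputable def growthOrder {n : ℕ} (F : EuclideanSpace ℂ (Fin n) → ℂ) : EReal :=
  ⨅ (ρ : ℝ) (_ : 0 ≤ ρ) (_ : growthType ρ F < ⊤), (ρ : EReal)

/-- `F` is an entire function on `ℂⁿ` of order (at most) `2` and at most of minimal type, that
is, of type zero with respect to the order `2`. -/
structure IsEntireMinimalType {n : ℕ} (F : EuclideanSpace ℂ (Fin n) → ℂ) : Prop where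
  entire : Differentiable ℂ F
  order_le : growthOrder F ≤ 2
  type_le : growthType 2 F ≤ 0

/-- The normalized Hermite function
`h_k(t) = (2^k k! √π)^(-1/2) (-1)^k e^(t²/2) (d/dt)^k e^(-t²)` on `ℝ`. -/
noncomputable def hermite1 (k : ℕ) (t : ℝ) : ℝ :=
  (Real.sqrt (2 ^ k * (k.factorial : ℝ) * Real.sqrt Real.pi))⁻¹ * (-1) ^ k *
    Real.exp (t ^ 2 / 2) * iteratedDeriv k (fun s : ℝ => Real.exp (-s ^ 2)) t

/-- The Hermite functions `Φ_α(x) = ∏ⱼ h_{αⱼ}(xⱼ)` on `ℝⁿ`. -/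
noncomputable def hermiteFun {n : ℕ} (α : Fin n → ℕ) (x : EuclideanSpace ℝ (Fin n)) : ℂ :=
  ((∏ j, hermite1 (α j) (x j) : ℝ) : ℂ)

end Pfannschmidt

namespace Pfannschmidt

/-! Restrict the transform to a complex line `w ↦ f̂(wy)` with `y` real, say of length one. The
decay of `f` makes this entire with growth about `exp((Im w)²/(2a))`, and the decay of `f̂` makes it
about `exp(-b u²/2)` on the real axis. A factor `exp(m w²/2)` trades growth in the imaginary
direction for growth in the real one. Phragmén–Lindelöf in sectors
(`exists_norm_le_exp_of_real_axis`) then carries the real-axis bound to the whole plane with the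
same multiplicative constant.

If `ab > 1`, some `m` lies strictly between `1/a` and `b`. The product is then bounded, constant by
Liouville, and tends to `0` along the real axis, so `f̂` vanishes away from the origin
(`GaussianDecay.fourier_eq_zero`), and Fourier inversion finishes.

If `ab = 1`, only `m = 1/a = b` is possible, with an arbitrarily small loss: the product is at most
`C exp(ε|w|²)` with `C` independent of the direction `y`. A general point of `ℂⁿ` is not a complex
multiple of a real vector; the maximum principle on the disc `p ↦ ζ + p ζ̄` reaches it
(`norm_le_of_forall_smul_toComplex`). This yields `S` (`GaussianDecay.isEntireMinimalType`). The
function `R` comes from the same argument applied to `f̂`, whose transform is `f(-x)` almost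
everywhere.

If `ab < 1`, Gaussians of rate `γ` with `a ≤ γ ≤ 1/b` work, since their transforms have rate `1/γ ≥
b`. Polynomial factors are preserved in form by the transform and are absorbed by `P` and `Q`, which
covers the Hermite functions. -/

/-! ### Phragmén–Lindelöf estimates in one variable -/

/-- Phragmén–Lindelöf in a sector of opening less than `π / 2`, for functions of order two. -/
theorem norm_le_of_sector {k : ℂ → ℂ} (hk : Differentiable ℂ k) {ψ : ℝ} (hψ0 : 0 < ψ)
    (hψ : ψ < Real.pi / 2) {B C D : ℝ}
    (hgrowth : ∀ w, ‖k w‖ ≤ D * Real.exp (B * ‖w‖ ^ 2))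
    (h0 : ∀ r : ℝ, 0 < r → ‖k r‖ ≤ C)
    (h1 : ∀ r : ℝ, 0 < r → ‖k (r * Complex.exp (ψ * Complex.I))‖ ≤ C)
    {r φ : ℝ} (hr : 0 < r) (hφ0 : 0 ≤ φ) (hφ : φ ≤ ψ) :
    ‖k (r * Complex.exp (φ * Complex.I))‖ ≤ C := by
  have hexp : ∀ ζ : ℂ, Complex.exp ζ = (Real.exp ζ.re : ℝ) * Complex.exp (ζ.im * Complex.I) := by
    intro ζ
    rw [Complex.ofReal_exp, ← Complex.exp_add, Complex.re_add_im]
  -- The exponential maps the strip `0 ≤ Im ζ ≤ ψ` onto the sector. Order-two growth becomes `exp(B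
  -- e^{2|Re ζ|})`, which is admissible because `2 < π/ψ`.
  have key := PhragmenLindelof.horizontal_strip (f := fun ζ => k (Complex.exp ζ)) (a := 0) (b := ψ)
    (C := C) (z := (Real.log r : ℂ) + φ * Complex.I)
    ((hk.comp Complex.differentiable_exp).diffContOnCl) ?_ ?_ ?_ (by simpa) (by simpa)
  · simpa [Complex.exp_add, ← Complex.ofReal_exp, Real.exp_log hr] using key
  · refine ⟨2, ?_, |B|, ?_⟩
    · rw [sub_zero, lt_div_iff₀ hψ0]
      linarith
    · refine Asymptotics.IsBigO.of_bound |D| (Eventually.of_forall fun ζ => ?_)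
      rw [Real.norm_of_nonneg (Real.exp_pos _).le]
      refine (hgrowth _).trans ?_
      have h2 : ‖Complex.exp ζ‖ ^ 2 ≤ Real.exp (2 * |ζ.re|) := by
        rw [Complex.norm_exp, ← Real.exp_nat_mul]
        exact Real.exp_le_exp.2 (by push_cast; linarith [le_abs_self ζ.re])
      have h3 : B * ‖Complex.exp ζ‖ ^ 2 ≤ |B| * Real.exp (2 * |ζ.re|) :=
        mul_le_mul (le_abs_self B) h2 (by positivity) (abs_nonneg _)
      exact mul_le_mul (le_abs_self D) (Real.exp_le_exp.2 h3) (Real.exp_pos _).le (abs_nonneg _)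
  · intro ζ hζ
    rw [hexp, hζ]
    simpa using h0 _ (Real.exp_pos ζ.re)
  · intro ζ hζ
    rw [hexp, hζ]
    exact h1 _ (Real.exp_pos ζ.re)

/-- The bound in the first quadrant, where `t` is the cosine of the opening of the sector. -/
theorem norm_le_exp_of_first_quadrant {K t C : ℝ} (hK : 0 < K) (ht0 : 0 < t) (ht1 : t < 1)
    {s : ℂ → ℂ} (hs : Differentiable ℂ s)
    (hgrowth : ∀ w : ℂ, ‖s w‖ ≤ C * Real.exp (K * w.re ^ 2 + K * t ^ 2 * w.im ^ 2))
    (hreal : ∀ u : ℝ, ‖s u‖ ≤ C * Real.exp (K * t ^ 2 * u ^ 2))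
    (w : ℂ) (hre : 0 ≤ w.re) (him : 0 ≤ w.im) :
    ‖s w‖ ≤ C * Real.exp (2 * K * t * ‖w‖ ^ 2) := by
  have hC : 0 ≤ C := by
    have := (norm_nonneg _).trans (hreal 0)
    simpa using this
  rcases eq_or_ne w 0 with rfl | hw
  · simpa using hreal 0
  have hwpos : 0 < ‖w‖ := norm_pos_iff.2 hw
  set ψ := Real.arccos t with hψ
  have hcos : Real.cos ψ = t := Real.cos_arccos (by linarith) ht1.le
  have hψ0 : 0 < ψ := Real.arccos_pos.2 ht1
  have hψ1 : ψ < Real.pi / 2 := Real.arccos_lt_pi_div_two.2 ht0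
  set A := 2 * K * t with hA
  have hA0 : 0 < A := by positivity
  have hsplit : ‖w‖ ^ 2 = w.re ^ 2 + w.im ^ 2 := by
    rw [← Complex.normSq_eq_norm_sq, Complex.normSq_apply]; ring
  set φ := w.arg with hφ
  have hwpol : w = (‖w‖ : ℂ) * Complex.exp (φ * Complex.I) :=
    (Complex.norm_mul_exp_arg_mul_I w).symm
  have hφ0 : 0 ≤ φ := Complex.arg_nonneg_iff.2 him
  have hφ2 : φ ≤ Real.pi / 2 := Complex.arg_le_pi_div_two_iff.2 (Or.inl hre)
  have hrecos : w.re = ‖w‖ * Real.cos φ := by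
    rw [hφ, Complex.norm_mul_cos_arg]
  -- Phragmén–Lindelöf is needed only up to the angle `ψ`. Beyond it `cos φ ≤ t`, and the growth
  -- hypothesis alone gives the exponent `2Kt² ≤ 2Kt`.
  rcases le_or_gt φ ψ with hle | hgt
  -- At angle `θ` the factor has modulus `exp(-A r² cos(2θ - ψ))`. The rotation by `ψ` makes it the
  -- same on both boundary rays, where `cos ψ = t` yields a decay rate `At = 2Kt²` that is just
  -- enough on the ray `θ = ψ`.
  · set k : ℂ → ℂ := fun z => s z * Complex.exp (-(A * z ^ 2 * Complex.exp (-(ψ * Complex.I))))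
      with hk
    have hnorm : ∀ r θ : ℝ, ‖Complex.exp (-(A * ((r : ℂ) * Complex.exp (θ * Complex.I)) ^ 2 *
        Complex.exp (-(ψ * Complex.I))))‖ = Real.exp (-(A * r ^ 2 * Real.cos (2 * θ - ψ))) := by
      intro r θ
      rw [Complex.norm_exp]
      congr 1
      have : -((A : ℂ) * ((r : ℂ) * Complex.exp (θ * Complex.I)) ^ 2 *
          Complex.exp (-(ψ * Complex.I))) =
          ((-(A * r ^ 2) : ℝ) : ℂ) * Complex.exp (((2 * θ - ψ : ℝ) : ℂ) * Complex.I) := by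
        rw [mul_pow, ← Complex.exp_nat_mul, mul_assoc, mul_assoc, ← Complex.exp_add]
        push_cast
        rw [show (2 : ℂ) * (θ * Complex.I) + -(ψ * Complex.I) = (2 * θ - ψ) * Complex.I by ring]
        ring
      rw [this, Complex.re_ofReal_mul, Complex.exp_ofReal_mul_I_re]
      ring
    have hkd : Differentiable ℂ k := by
      intro z
      simp only [hk]
      have := hs z
      fun_prop
    have hkb := norm_le_of_sector hkd hψ0 hψ1 (B := K + K * t ^ 2 + A) (C := C) (D := C)
      ?_ ?_ ?_ hwpos hφ0 hle
    · rw [hk] at hkb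
      simp only [norm_mul ] at hkb
      rw [hnorm, ← hwpol] at hkb
      rw [Real.exp_neg, ← div_eq_mul_inv, div_le_iff₀ (Real.exp_pos _)] at hkb
      refine hkb.trans (mul_le_mul_of_nonneg_left (Real.exp_le_exp.2 ?_) hC)
      have := Real.cos_le_one (2 * φ - ψ)
      have h4 : 0 ≤ A * ‖w‖ ^ 2 := by positivity
      nlinarith
    · intro z
      have hz : ‖z‖ ^ 2 = z.re ^ 2 + z.im ^ 2 := by
        rw [← Complex.normSq_eq_norm_sq, Complex.normSq_apply]; ring
      rw [hk]
      simp only [norm_mul]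
      have h5 : ‖Complex.exp (-(A * z ^ 2 * Complex.exp (-(ψ * Complex.I))))‖ ≤
          Real.exp (A * ‖z‖ ^ 2) := by
        refine (Complex.norm_exp_le_exp_norm _).trans (Real.exp_le_exp.2 ?_)
        rw [norm_neg, norm_mul, norm_mul, norm_pow, Complex.norm_real, Real.norm_of_nonneg hA0.le,
          ← neg_mul, ← Complex.ofReal_neg, Complex.norm_exp_ofReal_mul_I, mul_one]
      refine (mul_le_mul (hgrowth z) h5 (norm_nonneg _) (by positivity)).trans ?_
      rw [mul_assoc, ← Real.exp_add]
      refine mul_le_mul_of_nonneg_left (Real.exp_le_exp.2 ?_) hC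
      rw [hz]
      have h6 : 0 ≤ K * z.im ^ 2 := by positivity
      have h7 : 0 ≤ K * t ^ 2 * z.re ^ 2 := by positivity
      nlinarith
    · intro r hr
      have h8 := hnorm r 0
      simp only [Complex.ofReal_zero, zero_mul, Complex.exp_zero, mul_one, mul_zero, zero_sub,
        Real.cos_neg, hcos] at h8
      rw [hk]
      simp only [norm_mul, h8]
      refine (mul_le_mul_of_nonneg_right (hreal r) (Real.exp_pos _).le).trans ?_
      rw [mul_assoc, ← Real.exp_add]
      refine mul_le_of_le_one_right hC (Real.exp_le_one_iff.2 ?_)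
      have : 0 ≤ K * t ^ 2 * r ^ 2 := by positivity
      rw [hA]
      nlinarith
    · intro r hr
      have h8 := hnorm r ψ
      rw [show 2 * ψ - ψ = ψ by ring, hcos] at h8
      rw [hk]
      simp only [norm_mul, h8]
      have h9 : ‖s (r * Complex.exp (ψ * Complex.I))‖ ≤ C * Real.exp (A * r ^ 2 * t) := by
        refine (hgrowth _).trans (mul_le_mul_of_nonneg_left (Real.exp_le_exp.2 ?_) hC)
        rw [Complex.re_ofReal_mul, Complex.im_ofReal_mul, Complex.exp_ofReal_mul_I_re,
          Complex.exp_ofReal_mul_I_im, hcos, mul_pow, mul_pow]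
        have h10 : Real.sin ψ ^ 2 ≤ 1 := Real.sin_sq_le_one ψ
        have h11 : 0 ≤ K * t ^ 2 * r ^ 2 := by positivity
        rw [hA]
        nlinarith
      refine (mul_le_mul_of_nonneg_right h9 (Real.exp_pos _).le).trans ?_
      rw [mul_assoc, ← Real.exp_add, add_neg_cancel, Real.exp_zero, mul_one]
  · refine (hgrowth w).trans (mul_le_mul_of_nonneg_left (Real.exp_le_exp.2 ?_) hC)
    have h12 : Real.cos φ ≤ t := by
      rw [← hcos]
      exact Real.cos_le_cos_of_nonneg_of_le_pi hψ0.le (by linarith [Real.pi_pos]) hgt.le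
    have h13 : 0 ≤ Real.cos φ := Real.cos_nonneg_of_mem_Icc ⟨by linarith, hφ2⟩
    have h14 : w.re ^ 2 ≤ ‖w‖ ^ 2 * t ^ 2 := by
      rw [hrecos, mul_pow]
      exact mul_le_mul_of_nonneg_left (pow_le_pow_left₀ h13 h12 2) (by positivity)
    have h15 : w.im ^ 2 ≤ ‖w‖ ^ 2 := by rw [hsplit]; nlinarith [sq_nonneg w.re]
    have h16 : K * w.re ^ 2 ≤ K * (‖w‖ ^ 2 * t ^ 2) := mul_le_mul_of_nonneg_left h14 hK.le
    have h17 : K * t ^ 2 * w.im ^ 2 ≤ K * t ^ 2 * ‖w‖ ^ 2 :=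
      mul_le_mul_of_nonneg_left h15 (by positivity)
    have h18 : t ^ 2 ≤ t := by nlinarith
    have h19 : K * ‖w‖ ^ 2 * t ^ 2 ≤ K * ‖w‖ ^ 2 * t :=
      mul_le_mul_of_nonneg_left h18 (by positivity)
    rw [hA]
    linarith

/-- An entire function of order two which grows slowly on the real axis and in the imaginary
direction grows slowly everywhere; the constant is not affected. -/
theorem exists_norm_le_exp_of_real_axis {K ε : ℝ} (hK : 0 < K) (hε : 0 < ε) :
    ∃ δ > 0, ∀ (C : ℝ) (s : ℂ → ℂ), Differentiable ℂ s →
      (∀ w : ℂ, ‖s w‖ ≤ C * Real.exp (K * w.re ^ 2 + δ * w.im ^ 2)) →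
      (∀ u : ℝ, ‖s u‖ ≤ C * Real.exp (δ * u ^ 2)) →
      ∀ w : ℂ, ‖s w‖ ≤ C * Real.exp (ε * ‖w‖ ^ 2) := by
  -- The final exponent is `2Kt`, hence the second entry; the first only keeps `t < 1`, so that the
  -- sector is nondegenerate.
  set t := min (1 / 2) (ε / (2 * K)) with ht
  have ht0 : 0 < t := by positivity
  have ht1 : t < 1 := (min_le_left _ _).trans_lt (by norm_num)
  have htε : 2 * K * t ≤ ε := by
    have := min_le_right (1 / 2) (ε / (2 * K))
    rw [← ht, le_div_iff₀ (by positivity)] at this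
    linarith
  refine ⟨K * t ^ 2, by positivity, fun C s hs hgrowth hreal w => ?_⟩
  have hC : 0 ≤ C := by
    have := (norm_nonneg _).trans (hreal 0)
    simpa using this
  suffices h : ‖s w‖ ≤ C * Real.exp (2 * K * t * ‖w‖ ^ 2) from
    h.trans (mul_le_mul_of_nonneg_left
      (Real.exp_le_exp.2 (mul_le_mul_of_nonneg_right htε (by positivity))) hC)
  have upper : ∀ s : ℂ → ℂ, Differentiable ℂ s →
      (∀ w : ℂ, ‖s w‖ ≤ C * Real.exp (K * w.re ^ 2 + K * t ^ 2 * w.im ^ 2)) →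
      (∀ u : ℝ, ‖s u‖ ≤ C * Real.exp (K * t ^ 2 * u ^ 2)) →
      ∀ w : ℂ, 0 ≤ w.re → ‖s w‖ ≤ C * Real.exp (2 * K * t * ‖w‖ ^ 2) := by
    intro s hs hgrowth hreal w hre
    rcases le_total 0 w.im with him | him
    · exact norm_le_exp_of_first_quadrant hK ht0 ht1 hs hgrowth hreal w hre him
    · have := norm_le_exp_of_first_quadrant hK ht0 ht1
        (s := (starRingEnd ℂ) ∘ s ∘ (starRingEnd ℂ)) (C := C)
        (fun z => differentiableAt_conj_conj_iff.2 (hs _))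
        (fun z => by simpa using hgrowth ((starRingEnd ℂ) z)) (fun u => by simpa using hreal u)
        ((starRingEnd ℂ) w) (by simpa using hre) (by simpa using him)
      simpa using this
  rcases le_total 0 w.re with hre | hre
  · exact upper s hs hgrowth hreal w hre
  · have := upper (fun z => s (-z)) (hs.comp differentiable_neg)
      (fun z => by simpa using hgrowth (-z)) (fun u => by simpa using hreal (-u)) (-w)
      (by simpa using hre)
    simpa using this

/-! ### Growth of functions -/

theorem div_coe_le_of_log_le {p : ℝ≥0∞} {s ε M : ℝ} (hM : 0 < M)
    (hp : p ≤ ENNReal.ofReal (Real.exp s)) (hs : s ≤ ε * M) :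
    ENNReal.log p / (M : EReal) ≤ (ε : EReal) := by
  rw [EReal.div_le_iff_le_mul (by exact_mod_cast hM) (EReal.coe_ne_top _)]
  refine (ENNReal.log_le_log hp).trans ?_
  rw [ENNReal.log_ofReal_of_pos (Real.exp_pos _), Real.log_exp, ← EReal.coe_mul]
  exact_mod_cast hs.trans_eq (mul_comm _ _)

theorem nonpos_of_forall_pos_le {x : EReal} (h : ∀ ε : ℝ, 0 < ε → x ≤ (ε : EReal)) : x ≤ 0 := by
  refine EReal.le_of_forall_lt_iff_le.1 fun z hz => h z ?_
  exact_mod_cast hz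

theorem eventually_le_exp_of_logGrowth_eq_zero {n : ℕ} {P : EuclideanSpace ℝ (Fin n) → ℝ}
    (hP : logGrowth P = 0) {ε : ℝ} (hε : 0 < ε) :
    ∀ᶠ x in Bornology.cobounded (EuclideanSpace ℝ (Fin n)), P x ≤ Real.exp (ε * ‖x‖ ^ 2) := by
  have h1 : logGrowth P < (ε : EReal) := by rw [hP]; exact_mod_cast hε
  filter_upwards [eventually_lt_of_limsup_lt h1,
    tendsto_norm_cobounded_atTop.eventually_gt_atTop 0] with x hx hx0
  rcases le_or_gt (P x) 0 with h0 | h0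
  · exact h0.trans (Real.exp_pos _).le
  have h2 : 0 < ‖x‖ ^ 2 := by positivity
  have h3 := hx.le
  rw [EReal.div_le_iff_le_mul (by exact_mod_cast h2) (EReal.coe_ne_top _),
    ENNReal.log_ofReal_of_pos h0, ← EReal.coe_mul, EReal.coe_le_coe_iff,
    Real.log_le_iff_le_exp h0] at h3
  rwa [mul_comm]

/-- The bound `1 ≤ P` keeps the limsup from being negative, provided that the filter at infinity is
nontrivial. For `n = 0` that filter is `⊥` and the limsup is `-∞`. -/
theorem logGrowth_eq_zero {n : ℕ} (hn : 1 ≤ n) {P : EuclideanSpace ℝ (Fin n) → ℝ}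
    (hone : ∀ x, 1 ≤ P x) (hP : ∀ ε > 0, ∃ C, ∀ x, P x ≤ C * Real.exp (ε * ‖x‖ ^ 2)) :
    logGrowth P = 0 := by
  have : Nonempty (Fin n) := ⟨⟨0, hn⟩⟩
  apply le_antisymm
  · refine nonpos_of_forall_pos_le fun ε hε => ?_
    obtain ⟨C, hC⟩ := hP (ε / 2) (by positivity)
    have hC0 : 0 < C := by
      have := (hone 0).trans (hC 0)
      simp at this
      linarith
    refine limsup_le_of_le (h := ?_)
    have hlim : Tendsto (fun x : EuclideanSpace ℝ (Fin n) => ε / 2 * ‖x‖ ^ 2)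
        (Bornology.cobounded _) atTop :=
      ((tendsto_pow_atTop two_ne_zero).comp tendsto_norm_cobounded_atTop).const_mul_atTop
        (by positivity)
    filter_upwards [hlim.eventually_ge_atTop (Real.log C),
      tendsto_norm_cobounded_atTop.eventually_gt_atTop 0] with x hx hx0
    refine div_coe_le_of_log_le (s := Real.log C + ε / 2 * ‖x‖ ^ 2) (by positivity)
      (ENNReal.ofReal_le_ofReal ?_) (by linarith)
    rw [Real.exp_add, Real.exp_log hC0]
    exact hC x
  · refine le_limsup_of_frequently_le (Eventually.frequently (Eventually.of_forall fun x => ?_))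
    refine EReal.div_nonneg ?_ (by exact_mod_cast (by positivity : (0 : ℝ) ≤ ‖x‖ ^ 2))
    rw [ENNReal.zero_le_log_iff]
    exact ENNReal.one_le_ofReal.2 (hone x)

theorem isEntireMinimalType_of_norm_le {n : ℕ} {F : EuclideanSpace ℂ (Fin n) → ℂ}
    (hF : Differentiable ℂ F) (hb : ∀ ε > 0, ∃ C, ∀ z, ‖F z‖ ≤ C * Real.exp (ε * ‖z‖ ^ 2)) :
    IsEntireMinimalType F := by
  have htype : growthType 2 F ≤ 0 := by
    refine nonpos_of_forall_pos_le fun ε hε => ?_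
    obtain ⟨C, hC⟩ := hb (ε / 2) (by positivity)
    refine limsup_le_of_le (h := ?_)
    have hlim : Tendsto (fun r : ℝ => ε / 2 * r ^ 2) atTop atTop :=
      (tendsto_pow_atTop two_ne_zero).const_mul_atTop (by positivity)
    filter_upwards [hlim.eventually_ge_atTop (Real.log (|C| + 1)), eventually_gt_atTop 0]
      with r hr hr0
    rw [Real.rpow_two]
    refine div_coe_le_of_log_le (s := Real.log (|C| + 1) + ε / 2 * r ^ 2) (by positivity)
      ?_ (by linarith)
    refine iSup₂_le fun z hz => ?_
    rw [← ofReal_norm]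
    refine ENNReal.ofReal_le_ofReal ((hC z).trans ?_)
    rw [Real.exp_add, Real.exp_log (by positivity)]
    have hz' : ‖z‖ ≤ r := by simpa using hz
    refine mul_le_mul (by linarith [le_abs_self C]) (Real.exp_le_exp.2 ?_) (Real.exp_pos _).le
      (by positivity)
    gcongr
  refine ⟨hF, ?_, htype⟩
  -- Finite type with respect to `2` already puts `2` among the exponents over which the order is
  -- the infimum.
  refine iInf_le_of_le 2 (iInf_le_of_le zero_le_two (iInf_le_of_le ?_ le_rfl))
  exact htype.trans_lt EReal.zero_lt_top

/-! ### Fourier inversion almost everywhere -/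

-- Continuity of `f` is not available, so both sides are tested against smooth compactly supported
-- `φ`. With `χ = 𝓕⁻ φ`, moving the transform across the integral twice gives `∫ φ f = ∫ χ 𝓕 f = ∫ φ
-- 𝓕⁻(𝓕 f)`.
open scoped FourierTransform in
theorem ae_eq_fourierInv_fourier {n : ℕ} {f : EuclideanSpace ℝ (Fin n) → ℂ} (hf : Integrable f)
    (hf' : Integrable (𝓕 f)) : f =ᵐ[volume] 𝓕⁻ (𝓕 f) := by
  have hcinner : Continuous fun p : EuclideanSpace ℝ (Fin n) × EuclideanSpace ℝ (Fin n) =>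
      (-innerₗ (EuclideanSpace ℝ (Fin n))) p.1 p.2 :=
    (continuous_inner (𝕜 := ℝ) (E := EuclideanSpace ℝ (Fin n))).neg
  have hcont : Continuous (𝓕⁻ (𝓕 f)) :=
    VectorFourier.fourierIntegral_continuous (L := -innerₗ (EuclideanSpace ℝ (Fin n)))
      Real.continuous_fourierChar
      hcinner hf'
  refine ae_eq_of_integral_contDiff_smul_eq hf.locallyIntegrable hcont.locallyIntegrable ?_
  intro g hg hgs
  have hgs' : HasCompactSupport (fun x => (g x : ℂ)) := hgs.comp_left Complex.ofReal_zero
  have hg' : ContDiff ℝ (↑(⊤ : ℕ∞)) (fun x => (g x : ℂ)) := Complex.ofRealCLM.contDiff.comp hg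
  let φ : SchwartzMap (EuclideanSpace ℝ (Fin n)) ℂ := hgs'.toSchwartzMap hg'
  have hφ : ∀ x, φ x = (g x : ℂ) := fun x => rfl
  let χ : SchwartzMap (EuclideanSpace ℝ (Fin n)) ℂ := 𝓕⁻ φ
  have h1 := VectorFourier.integral_fourierIntegral_smul_eq_flip
    (L := innerₗ (EuclideanSpace ℝ (Fin n))) Real.continuous_fourierChar continuous_inner
    (χ.integrable (μ := volume)) hf
  have h2 := VectorFourier.integral_fourierIntegral_smul_eq_flip
    (L := -innerₗ (EuclideanSpace ℝ (Fin n))) Real.continuous_fourierChar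
    hcinner (φ.integrable (μ := volume)) hf'
  have e1 : VectorFourier.fourierIntegral Real.fourierChar volume
      (innerₗ (EuclideanSpace ℝ (Fin n))) χ = φ := by
    have : 𝓕 χ = φ := FourierTransform.fourier_fourierInv_eq φ
    conv_rhs => rw [← this]
    rfl
  have e2 : VectorFourier.fourierIntegral Real.fourierChar volume
      (-innerₗ (EuclideanSpace ℝ (Fin n))) φ = χ := by
    rw [SchwartzMap.fourierInv_coe]; rfl
  have e3 : VectorFourier.fourierIntegral Real.fourierChar volume
      (innerₗ (EuclideanSpace ℝ (Fin n))).flip f = 𝓕 f := by rw [flip_innerₗ]; rfl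
  have e4 : VectorFourier.fourierIntegral Real.fourierChar volume
      (-innerₗ (EuclideanSpace ℝ (Fin n))).flip (𝓕 f) = 𝓕⁻ (𝓕 f) := by
    have : (-innerₗ (EuclideanSpace ℝ (Fin n))).flip = -innerₗ (EuclideanSpace ℝ (Fin n)) := by
      ext x y; simp [real_inner_comm]
    rw [this]; rfl
  rw [e1, e3] at h1
  rw [e2, e4] at h2
  simp only [hφ] at h1 h2
  simpa using h1.trans h2

open scoped FourierTransform in
theorem fourier_eq_fourierIntegral {n : ℕ} (f : EuclideanSpace ℝ (Fin n) → ℂ)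
    (ξ : EuclideanSpace ℝ (Fin n)) :
    fourier f ξ = (((2 * Real.pi) ^ (-(n : ℝ) / 2) : ℝ) : ℂ) *
      𝓕 f ((2 * Real.pi)⁻¹ • ξ) := by
  rw [fourier, Real.fourier_eq']
  congr 2
  ext x
  rw [smul_eq_mul, inner_smul_right]
  congr 2
  have : (Real.pi : ℂ) ≠ 0 := by exact_mod_cast Real.pi_ne_zero
  push_cast
  field_simp

open scoped FourierTransform in
theorem ae_eq_fourier_fourier_neg {n : ℕ} {f : EuclideanSpace ℝ (Fin n) → ℂ}
    (hf : Integrable f) (hf' : Integrable (fourier f)) :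
    ∀ᵐ x, f x = fourier (fourier f) (-x) := by
  have hpi : (0 : ℝ) < 2 * Real.pi := by positivity
  set c : ℝ := (2 * Real.pi) ^ (-(n : ℝ) / 2) with hc
  have hc0 : 0 < c := by positivity
  have hF : 𝓕 f = fun v => (c : ℂ)⁻¹ * fourier f ((2 * Real.pi) • v) := by
    ext v
    rw [fourier_eq_fourierIntegral, smul_smul, inv_mul_cancel₀ hpi.ne', one_smul, ← mul_assoc,
      inv_mul_cancel₀ (by exact_mod_cast hc0.ne'), one_mul]
  have hFi : Integrable (𝓕 f) := by
    rw [hF]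
    exact (hf'.comp_smul hpi.ne').const_mul _
  filter_upwards [ae_eq_fourierInv_fourier hf hFi] with x hx
  rw [hx, Real.fourierInv_eq', fourier]
  have h1 := Measure.integral_comp_smul (volume : Measure (EuclideanSpace ℝ (Fin n)))
    (fun ξ => Complex.exp (-Complex.I * ((inner ℝ ξ (-x) : ℝ) : ℂ)) * fourier f ξ) (2 * Real.pi)
  have h2 : ∀ v : EuclideanSpace ℝ (Fin n),
      Complex.exp (((2 * Real.pi * inner ℝ v x : ℝ) : ℂ) * Complex.I) • 𝓕 f v =
      (c : ℂ)⁻¹ * (Complex.exp (-Complex.I * ((inner ℝ ((2 * Real.pi) • v) (-x) : ℝ) : ℂ)) *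
        fourier f ((2 * Real.pi) • v)) := by
    intro v
    rw [hF, smul_eq_mul, inner_smul_left, inner_neg_right]
    simp only [conj_trivial]
    rw [mul_left_comm]
    congr 3
    push_cast
    ring
  simp_rw [h2]
  rw [integral_const_mul, h1, finrank_euclideanSpace_fin, abs_of_pos (by positivity),
    Complex.real_smul, ← mul_assoc]
  congr 1
  -- The Jacobian of the substitution `ξ = 2πv` is the product of the two normalizing constants.
  have h3 : c * c = ((2 * Real.pi) ^ n)⁻¹ := by
    rw [hc, ← Real.rpow_add hpi, ← Real.rpow_natCast, ← Real.rpow_neg hpi.le]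
    congr 1
    ring
  rw [← h3]
  push_cast
  have hc1 : (c : ℂ) ≠ 0 := by exact_mod_cast hc0.ne'
  rw [inv_mul_cancel_left₀ hc1]

/-! ### The entire extension of the Fourier transform -/

variable {n : ℕ}

@[simp]
theorem toComplex_apply (x : EuclideanSpace ℝ (Fin n)) (j : Fin n) : toComplex x j = (x j : ℂ) :=
  rfl

@[simp]
theorem norm_toComplex (x : EuclideanSpace ℝ (Fin n)) : ‖toComplex x‖ = ‖x‖ := by
  simp [EuclideanSpace.norm_eq]

theorem continuous_toComplex :
    Continuous (toComplex : EuclideanSpace ℝ (Fin n) → EuclideanSpace ℂ (Fin n)) := by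
  unfold toComplex
  fun_prop

theorem inner_toComplex (x y : EuclideanSpace ℝ (Fin n)) :
    inner ℂ (toComplex x) (toComplex y) = ((inner ℝ x y : ℝ) : ℂ) := by
  simp [PiLp.inner_apply]

theorem sq_smul_toComplex (w : ℂ) (x : EuclideanSpace ℝ (Fin n)) :
    sq (w • toComplex x) = w ^ 2 * ((‖x‖ ^ 2 : ℝ) : ℂ) := by
  simp [sq, EuclideanSpace.norm_sq_eq, mul_pow, Finset.mul_sum]

/-- The extension of `fourier f` to complex arguments. -/
noncomputable def fourierExt (f : EuclideanSpace ℝ (Fin n) → ℂ) (z : EuclideanSpace ℂ (Fin n)) :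
    ℂ :=
  (((2 * Real.pi) ^ (-(n : ℝ) / 2) : ℝ) : ℂ) *
    ∫ x, Complex.exp (-Complex.I * inner ℂ (toComplex x) z) * f x

theorem fourierExt_toComplex (f : EuclideanSpace ℝ (Fin n) → ℂ) (ξ : EuclideanSpace ℝ (Fin n)) :
    fourierExt f (toComplex ξ) = fourier f ξ := by
  simp only [fourierExt, fourier, inner_toComplex]

/-- This is `(as - t)² ≥ 0`; through it a Gaussian weight absorbs the exponential kernel. -/
theorem mul_le_mul_sq_add_sq_div {a : ℝ} (ha : 0 < a) (s t : ℝ) :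
    s * t ≤ a * s ^ 2 / 2 + t ^ 2 / (2 * a) := by
  have h : a * s ^ 2 / 2 + t ^ 2 / (2 * a) - s * t = (a * s - t) ^ 2 / (2 * a) := by
    field_simp
    ring
  have : 0 ≤ (a * s - t) ^ 2 / (2 * a) := by positivity
  linarith

theorem norm_exp_inner_toComplex_le (x : EuclideanSpace ℝ (Fin n))
    (z : EuclideanSpace ℂ (Fin n)) :
    ‖Complex.exp (-Complex.I * inner ℂ (toComplex x) z)‖ ≤ Real.exp (‖x‖ * ‖z‖) := by
  refine (Complex.norm_exp_le_exp_norm _).trans (Real.exp_le_exp.2 ?_)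
  rw [norm_mul, norm_neg, Complex.norm_I, one_mul, ← norm_toComplex x]
  exact norm_inner_le_norm _ _

theorem continuous_exp_inner_toComplex (z : EuclideanSpace ℂ (Fin n)) :
    Continuous fun x => Complex.exp (-Complex.I * inner ℂ (toComplex x) z) := by
  have := continuous_toComplex (n := n)
  fun_prop

theorem differentiable_fourierExt {f : EuclideanSpace ℝ (Fin n) → ℂ}
    (hf : AEStronglyMeasurable f volume) {a : ℝ} (ha : 0 < a)
    (hint : Integrable fun x => Real.exp (a * ‖x‖ ^ 2 / 2) * ‖f x‖) :
    Differentiable ℂ (fourierExt f) := by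
  intro z₀
  refine DifferentiableAt.const_mul ?_ _
  set M := ‖z₀‖ + 1 with hM
  -- The factor `1 + ‖x‖` dominates the kernel and its derivative at once. Since `1 + ‖x‖ ≤ e^‖x‖`,
  -- it costs only the passage from `M` to `M + 1`.
  have hb : ∀ (x : EuclideanSpace ℝ (Fin n)) (z : EuclideanSpace ℂ (Fin n)), ‖z‖ ≤ M →
      ‖Complex.exp (-Complex.I * inner ℂ (toComplex x) z) * f x‖ * (1 + ‖x‖) ≤
      Real.exp ((M + 1) ^ 2 / (2 * a)) * (Real.exp (a * ‖x‖ ^ 2 / 2) * ‖f x‖) := by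
    intro x z hz
    rw [norm_mul, mul_right_comm, ← mul_assoc]
    refine mul_le_mul_of_nonneg_right ?_ (norm_nonneg _)
    have h1 : ‖Complex.exp (-Complex.I * inner ℂ (toComplex x) z)‖ ≤ Real.exp (‖x‖ * M) :=
      (norm_exp_inner_toComplex_le x z).trans
        (Real.exp_le_exp.2 (mul_le_mul_of_nonneg_left hz (norm_nonneg _)))
    have h2 : 1 + ‖x‖ ≤ Real.exp ‖x‖ := by linarith [Real.add_one_le_exp ‖x‖]
    refine (mul_le_mul h1 h2 (by positivity) (Real.exp_pos _).le).trans ?_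
    rw [← Real.exp_add, ← Real.exp_add]
    refine Real.exp_le_exp.2 ?_
    linarith [mul_le_mul_sq_add_sq_div ha ‖x‖ (M + 1)]
  have hmeas : ∀ z : EuclideanSpace ℂ (Fin n), AEStronglyMeasurable
      (fun x => Complex.exp (-Complex.I * inner ℂ (toComplex x) z) * f x) volume := fun z =>
    (continuous_exp_inner_toComplex z).aestronglyMeasurable.mul hf
  refine (hasFDerivAt_integral_of_dominated_of_fderiv_le (𝕜 := ℂ) (s := Metric.ball z₀ 1)
    (bound := fun x => Real.exp ((M + 1) ^ 2 / (2 * a)) * (Real.exp (a * ‖x‖ ^ 2 / 2) * ‖f x‖))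
    (F' := fun z x => (Complex.exp (-Complex.I * inner ℂ (toComplex x) z) * f x) •
      (-Complex.I • innerSL ℂ (toComplex x)))
    (Metric.ball_mem_nhds z₀ one_pos) (Eventually.of_forall hmeas) ?_ ?_ ?_ (hint.const_mul _)
    ?_).differentiableAt
  · refine (hint.const_mul (Real.exp ((M + 1) ^ 2 / (2 * a)))).mono' (hmeas z₀)
      (Eventually.of_forall fun x => ?_)
    refine le_trans ?_ (hb x z₀ (by linarith))
    exact le_mul_of_one_le_right (norm_nonneg _) (by linarith [norm_nonneg x])
  · refine (hmeas z₀).smul (Continuous.aestronglyMeasurable ?_)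
    exact ((innerSL ℂ).continuous.comp continuous_toComplex).const_smul (-Complex.I)
  · refine Eventually.of_forall fun x z hz => ?_
    have hz' : ‖z‖ ≤ M := by
      have h3 : ‖z - z₀‖ < 1 := by simpa [dist_eq_norm] using hz
      have h4 := norm_add_le (z - z₀) z₀
      rw [sub_add_cancel] at h4
      linarith
    refine le_trans ?_ (hb x z hz')
    rw [norm_smul]
    refine mul_le_mul_of_nonneg_left ?_ (norm_nonneg _)
    rw [norm_smul, norm_neg, Complex.norm_I, one_mul, innerSL_apply_norm, norm_toComplex]
    linarith
  · refine Eventually.of_forall fun x z _ => ?_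
    have h5 : HasFDerivAt (fun z => inner ℂ (toComplex x) z) (innerSL ℂ (toComplex x)) z :=
      (innerSL ℂ (toComplex x)).hasFDerivAt
    have h6 := ((h5.const_mul (-Complex.I)).cexp).mul_const (f x)
    refine h6.congr_fderiv ?_
    ext v
    simp
    ring

/-- Along a real direction the modulus of the kernel depends on `w` only through `Im w`, so there is
no growth in `Re w`; completing the square does the rest. -/
theorem norm_fourierExt_smul_toComplex_le {f : EuclideanSpace ℝ (Fin n) → ℂ} {a : ℝ} (ha : 0 < a)
    (hint : Integrable fun x => Real.exp (a * ‖x‖ ^ 2 / 2) * ‖f x‖) (w : ℂ)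
    (y : EuclideanSpace ℝ (Fin n)) :
    ‖fourierExt f (w • toComplex y)‖ ≤
      (2 * Real.pi) ^ (-(n : ℝ) / 2) * (∫ x, Real.exp (a * ‖x‖ ^ 2 / 2) * ‖f x‖) *
        Real.exp (w.im ^ 2 * ‖y‖ ^ 2 / (2 * a)) := by
  rw [fourierExt, norm_mul, Complex.norm_real, Real.norm_of_nonneg (by positivity), mul_assoc]
  refine mul_le_mul_of_nonneg_left ?_ (by positivity)
  rw [← integral_mul_const]
  refine norm_integral_le_of_norm_le (hint.mul_const _) (Eventually.of_forall fun x => ?_)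
  rw [norm_mul, mul_right_comm]
  refine mul_le_mul_of_nonneg_right ?_ (norm_nonneg _)
  rw [inner_smul_right, inner_toComplex, Complex.norm_exp, ← Real.exp_add]
  refine Real.exp_le_exp.2 ?_
  have h1 : (-Complex.I * (w * ((inner ℝ x y : ℝ) : ℂ))).re = w.im * inner ℝ x y := by
    simp [Complex.mul_re, Complex.mul_im]
  rw [h1]
  have h2 : w.im * inner ℝ x y ≤ ‖x‖ * (|w.im| * ‖y‖) := by
    refine (le_abs_self _).trans ?_
    rw [abs_mul]
    nlinarith [abs_real_inner_le_norm x y, abs_nonneg w.im]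
  have h3 := mul_le_mul_sq_add_sq_div ha ‖x‖ (|w.im| * ‖y‖)
  rw [mul_pow, sq_abs] at h3
  linarith

/-! ### From real directions to all of `ℂⁿ` -/

/-- A vector of the form `ζ + p ζ̄` with `|p| = 1` is a complex multiple of a real vector. -/
theorem exists_smul_toComplex (ζ : EuclideanSpace ℂ (Fin n)) {p : ℂ} (hp : ‖p‖ = 1) :
    ∃ (w : ℂ) (x : EuclideanSpace ℝ (Fin n)),
      ζ + p • (WithLp.toLp 2 fun j => (starRingEnd ℂ) (ζ j)) = w • toComplex x := by
  -- For `p = w²` with `|w| = 1`, `ζ + w² ζ̄ = w (w̄ ζ + w ζ̄)`, and the bracket is twice a real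
  -- part.
  obtain ⟨w, rfl⟩ := IsAlgClosed.exists_pow_nat_eq p two_pos
  have hw : ‖w‖ = 1 := (pow_eq_one_iff_of_nonneg (norm_nonneg w) two_ne_zero).1
    (by rwa [norm_pow] at hp)
  have hww : w * (starRingEnd ℂ) w = 1 := by
    rw [Complex.mul_conj, Complex.normSq_eq_norm_sq, hw]; norm_num
  refine ⟨w, WithLp.toLp 2 fun j => 2 * ((starRingEnd ℂ) w * ζ j).re, ?_⟩
  ext j
  have h := Complex.add_conj ((starRingEnd ℂ) w * ζ j)
  rw [map_mul, Complex.conj_conj] at h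
  simp only [PiLp.add_apply, PiLp.smul_apply, smul_eq_mul, toComplex_apply]
  rw [← h]
  linear_combination (-(ζ j)) * hww

/-- By the maximum principle, a bound on complex multiples of real vectors extends to `ℂⁿ`. -/
theorem norm_le_of_forall_smul_toComplex {S : EuclideanSpace ℂ (Fin n) → ℂ}
    (hS : Differentiable ℂ S) {ε C : ℝ} (hε : 0 ≤ ε) (hC : 0 ≤ C)
    (hb : ∀ (w : ℂ) (x : EuclideanSpace ℝ (Fin n)),
      ‖S (w • toComplex x)‖ ≤ C * Real.exp (ε * ‖w • toComplex x‖ ^ 2))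
    (ζ : EuclideanSpace ℂ (Fin n)) : ‖S ζ‖ ≤ C * Real.exp (4 * ε * ‖ζ‖ ^ 2) := by
  set ζ' : EuclideanSpace ℂ (Fin n) := WithLp.toLp 2 fun j => (starRingEnd ℂ) (ζ j) with hζ'
  have hnorm : ‖ζ'‖ = ‖ζ‖ := by simp [EuclideanSpace.norm_eq, hζ']
  have hd : Differentiable ℂ fun p : ℂ => S (ζ + p • ζ') :=
    hS.comp ((differentiable_id.smul_const ζ').const_add ζ)
  -- The disc `p ↦ ζ + p ζ̄` has centre `ζ`, and its boundary consists of complex multiples of real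
  -- vectors of norm at most `2‖ζ‖`; hence the factor `4`.
  have key := Complex.norm_le_of_forall_mem_frontier_norm_le
    (U := Metric.ball (0 : ℂ) 1) (f := fun p : ℂ => S (ζ + p • ζ')) (z := 0)
    (C := C * Real.exp (4 * ε * ‖ζ‖ ^ 2)) Metric.isBounded_ball hd.diffContOnCl ?_
    (subset_closure (Metric.mem_ball_self one_pos))
  · simpa using key
  · intro p hp
    rw [frontier_ball _ one_ne_zero, mem_sphere_zero_iff_norm] at hp
    obtain ⟨w, x, hwx⟩ := exists_smul_toComplex ζ hp
    rw [hwx]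
    refine (hb w x).trans (mul_le_mul_of_nonneg_left (Real.exp_le_exp.2 ?_) hC)
    rw [← hwx]
    have h1 : ‖ζ + p • ζ'‖ ≤ 2 * ‖ζ‖ := by
      refine (norm_add_le _ _).trans ?_
      rw [norm_smul, hp, hnorm]
      linarith
    have h2 : ‖ζ + p • ζ'‖ ^ 2 ≤ (2 * ‖ζ‖) ^ 2 := pow_le_pow_left₀ (norm_nonneg _) h1 2
    nlinarith

/-! ### The key estimates -/

/-- `f` and its Fourier transform decay almost like `exp (-a|x|²/2)` and `exp (-b|ξ|²/2)`. -/
structure GaussianDecay (a b : ℝ) (f : EuclideanSpace ℝ (Fin n) → ℂ) : Prop where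
  integrable : Integrable f
  integrable_exp_mul : ∀ a', 0 < a' → a' < a →
    Integrable fun x => Real.exp (a' * ‖x‖ ^ 2 / 2) * ‖f x‖
  bound_fourier : ∀ b', 0 < b' → b' < b →
    ∃ C, ∀ ξ, ‖fourier f ξ‖ ≤ C * Real.exp (-(b' * ‖ξ‖ ^ 2 / 2))

theorem GaussianDecay.differentiable {a b : ℝ} (ha : 0 < a) {f : EuclideanSpace ℝ (Fin n) → ℂ}
    (hf : GaussianDecay a b f) : Differentiable ℂ (fourierExt f) :=
  differentiable_fourierExt hf.integrable.aestronglyMeasurable (half_pos ha)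
    (hf.integrable_exp_mul _ (half_pos ha) (half_lt_self ha))

/-- The restriction of an entire function to complex multiples of a real vector. -/
theorem differentiable_comp_smul_toComplex {G : EuclideanSpace ℂ (Fin n) → ℂ}
    (hG : Differentiable ℂ G) (x : EuclideanSpace ℝ (Fin n)) :
    Differentiable ℂ fun w : ℂ => G (w • toComplex x) :=
  hG.comp (differentiable_id.smul_const _)

theorem ofReal_smul_toComplex (u : ℝ) (x : EuclideanSpace ℝ (Fin n)) :
    (u : ℂ) • toComplex x = toComplex (u • x) := by
  ext j; simp

theorem norm_cexp_mul_sq (m : ℝ) (w : ℂ) :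
    ‖Complex.exp (m * w ^ 2)‖ = Real.exp (m * (w.re ^ 2 - w.im ^ 2)) := by
  rw [Complex.norm_exp, Complex.re_ofReal_mul]
  congr 2
  simp [pow_two]

/-- On each line through a real unit vector, `exp(z²/(2a))` cancels both the imaginary growth and
the real decay up to `δ`. The constant does not depend on the line, so the maximum principle applies
to all of `ℂⁿ`. -/
theorem GaussianDecay.isEntireMinimalType {a : ℝ} (ha : 0 < a)
    {f : EuclideanSpace ℝ (Fin n) → ℂ} (hf : GaussianDecay a (1 / a) f) :
    IsEntireMinimalType fun z => fourierExt f z * Complex.exp (sq z / (2 * (a : ℂ))) := by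
  have hG := hf.differentiable ha
  have hsq : Differentiable ℂ (sq : EuclideanSpace ℂ (Fin n) → ℂ) := by
    unfold sq
    fun_prop
  have hS : Differentiable ℂ fun z => fourierExt f z * Complex.exp (sq z / (2 * (a : ℂ))) :=
    hG.mul (by simpa only [div_eq_mul_inv] using (hsq.mul_const _).cexp)
  refine isEntireMinimalType_of_norm_le hS fun ε hε => ?_
  -- The quarter of `ε` pays for the factor `4` in `norm_le_of_forall_smul_toComplex`.
  obtain ⟨δ, hδ, hPL⟩ := exists_norm_le_exp_of_real_axis (K := 1 / (2 * a)) (ε := ε / 4)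
    (by positivity) (by positivity)
  -- Solves `1/(2a') = 1/(2a) + δ`, so that the imaginary growth left over is exactly `δ`.
  set a' := 1 / (1 / a + 2 * δ) with ha'
  have ha'0 : 0 < a' := by positivity
  have ha'a : a' < a := by
    rw [ha', div_lt_iff₀ (by positivity)]
    have : a * (1 / a + 2 * δ) = 1 + 2 * (a * δ) := by field_simp
    rw [this]
    have : 0 < a * δ := by positivity
    linarith
  have hadelta : 1 / (2 * a') = 1 / (2 * a) + δ := by
    rw [ha']; field_simp
  -- A loss of `2δ` in the rate leaves `δ` on the real axis; the cap `1/(2a)` keeps `b'` positive.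
  set b' := 1 / a - min (2 * δ) (1 / (2 * a)) with hb'
  have hb'0 : 0 < b' := by
    have h1 := min_le_right (2 * δ) (1 / (2 * a))
    have h2 : 1 / (2 * a) < 1 / a := by
      rw [one_div_lt_one_div (by positivity) ha]; linarith
    linarith
  have hb'a : b' < 1 / a := by
    have : 0 < min (2 * δ) (1 / (2 * a)) := by positivity
    linarith
  have hbdelta : 1 / a - b' ≤ 2 * δ := by
    have := min_le_left (2 * δ) (1 / (2 * a))
    linarith
  obtain ⟨C₂, hC₂⟩ := hf.bound_fourier b' hb'0 hb'a
  have hC₁ := norm_fourierExt_smul_toComplex_le ha'0 (hf.integrable_exp_mul a' ha'0 ha'a)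
  set C₁ := (2 * Real.pi) ^ (-(n : ℝ) / 2) *
    ∫ x : EuclideanSpace ℝ (Fin n), Real.exp (a' * ‖x‖ ^ 2 / 2) * ‖f x‖ with hC₁def
  set C := max C₁ C₂ with hC
  have hC1 : C₁ ≤ C := le_max_left _ _
  have hC2 : C₂ ≤ C := le_max_right _ _
  have hC10 : 0 ≤ C₁ := by
    have : 0 ≤ ∫ x : EuclideanSpace ℝ (Fin n), Real.exp (a' * ‖x‖ ^ 2 / 2) * ‖f x‖ :=
      integral_nonneg fun x => by positivity
    positivity
  have hC0 : 0 ≤ C := hC10.trans hC1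
  have hexp : ∀ (w : ℂ) (y : EuclideanSpace ℝ (Fin n)), ‖y‖ = 1 →
      ‖Complex.exp (sq (w • toComplex y) / (2 * (a : ℂ)))‖ =
        Real.exp (1 / (2 * a) * (w.re ^ 2 - w.im ^ 2)) := by
    intro w y hy
    rw [← norm_cexp_mul_sq, sq_smul_toComplex, hy]
    congr 2
    push_cast
    ring
  have hunit : ∀ y : EuclideanSpace ℝ (Fin n), ‖y‖ = 1 → ∀ w : ℂ,
      ‖fourierExt f (w • toComplex y) * Complex.exp (sq (w • toComplex y) / (2 * (a : ℂ)))‖ ≤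
        C * Real.exp (ε / 4 * ‖w‖ ^ 2) := by
    intro y hy
    refine hPL C _ (differentiable_comp_smul_toComplex hS y) ?_ ?_
    · intro w
      rw [norm_mul, hexp w y hy]
      have h1 := (hC₁ w y).trans (mul_le_mul_of_nonneg_right hC1 (Real.exp_pos _).le)
      refine (mul_le_mul_of_nonneg_right h1 (Real.exp_pos _).le).trans ?_
      rw [mul_assoc, ← Real.exp_add]
      refine mul_le_mul_of_nonneg_left (Real.exp_le_exp.2 ?_) hC0
      rw [hy, div_eq_mul_one_div, hadelta]
      apply le_of_eq
      ring
    · intro u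
      rw [norm_mul, hexp u y hy, ofReal_smul_toComplex, fourierExt_toComplex]
      have h1 := (hC₂ (u • y)).trans (mul_le_mul_of_nonneg_right hC2 (Real.exp_pos _).le)
      refine (mul_le_mul_of_nonneg_right h1 (Real.exp_pos _).le).trans ?_
      rw [mul_assoc, ← Real.exp_add]
      refine mul_le_mul_of_nonneg_left (Real.exp_le_exp.2 ?_) hC0
      rw [norm_smul, hy, mul_one, Real.norm_eq_abs, sq_abs, Complex.ofReal_re, Complex.ofReal_im]
      have h2 : 1 / (2 * a) = 1 / a / 2 := by field_simp
      rw [h2]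
      nlinarith [sq_nonneg u]
  refine ⟨C, fun z => ?_⟩
  have := norm_le_of_forall_smul_toComplex hS (ε := ε / 4) (by positivity) hC0 ?_ z
  · rwa [show 4 * (ε / 4) = ε by ring] at this
  · intro w x
    rcases eq_or_ne x 0 with rfl | hx
    · have h0 : toComplex (0 : EuclideanSpace ℝ (Fin n)) = 0 := by ext j; simp
      have h1 := hC₁ 0 0
      rw [h0] at h1 ⊢
      simp [sq] at h1 ⊢
      exact h1.trans hC1
    · have hx0 : ‖x‖ ≠ 0 := norm_ne_zero_iff.2 hx
      have h1 := hunit (‖x‖⁻¹ • x) (by rw [norm_smul, norm_inv, norm_norm, inv_mul_cancel₀ hx0])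
        (w * (‖x‖ : ℂ))
      have h2 : (w * (‖x‖ : ℂ)) • toComplex (‖x‖⁻¹ • x) = w • toComplex x := by
        rw [mul_smul, ofReal_smul_toComplex, smul_inv_smul₀ hx0]
      rw [h2] at h1
      rw [norm_smul, norm_toComplex]
      simpa using h1

/-- Hardy's theorem in the strict range: the Fourier transform vanishes. -/
theorem GaussianDecay.fourier_eq_zero {a b : ℝ} (ha : 0 < a) (hb : 0 < b) (hab : 1 < a * b)
    {f : EuclideanSpace ℝ (Fin n) → ℂ} (hf : GaussianDecay a b f) (ξ : EuclideanSpace ℝ (Fin n))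
    (hξ : ξ ≠ 0) : fourier f ξ = 0 := by
  -- The parameters satisfy `1/a' < m < b'` with `a' < a` and `b' < b`. Thus the factor of rate `m`
  -- beats the imaginary growth and still leaves decay on the real axis.
  have hlt : 1 / b < a := by rw [div_lt_iff₀ hb]; exact hab
  obtain ⟨a', h1, h2⟩ := exists_between hlt
  have ha'0 : 0 < a' := lt_trans (by positivity) h1
  have hlt' : 1 / a' < b := by
    rw [div_lt_iff₀ ha'0]; rw [div_lt_iff₀ hb] at h1; linarith
  obtain ⟨b', h3, h4⟩ := exists_between hlt'
  have hb'0 : 0 < b' := lt_trans (by positivity) h3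
  obtain ⟨m, h5, h6⟩ := exists_between h3
  have hm0 : 0 < m := lt_trans (by positivity) h5
  have hG := hf.differentiable ha
  obtain ⟨C₂, hC₂⟩ := hf.bound_fourier b' hb'0 h4
  have hC₁ := norm_fourierExt_smul_toComplex_le ha'0 (hf.integrable_exp_mul a' ha'0 h2)
  set C₁ := (2 * Real.pi) ^ (-(n : ℝ) / 2) *
    ∫ x : EuclideanSpace ℝ (Fin n), Real.exp (a' * ‖x‖ ^ 2 / 2) * ‖f x‖
  set C := max C₁ C₂ with hC
  have hC1 : C₁ ≤ C := le_max_left _ _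
  have hC2 : C₂ ≤ C := le_max_right _ _
  have hC20 : 0 ≤ C₂ := by
    have := (norm_nonneg _).trans (hC₂ 0)
    simpa using this
  have hC0 : 0 ≤ C := hC20.trans hC2
  set N := ‖ξ‖ ^ 2 with hN
  have hN0 : 0 < N := by have := norm_pos_iff.2 hξ; positivity
  set k : ℂ → ℂ := fun w => fourierExt f (w • toComplex ξ) *
    Complex.exp ((m * N / 2 : ℝ) * w ^ 2) with hk
  have hkd : Differentiable ℂ k :=
    (differentiable_comp_smul_toComplex hG ξ).mul (by fun_prop)
  have hkreal : ∀ u : ℝ, ‖k u‖ ≤ C * Real.exp (-((b' - m) * N / 2) * u ^ 2) := by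
    intro u
    rw [hk]
    simp only
    rw [norm_mul, norm_cexp_mul_sq, ofReal_smul_toComplex, fourierExt_toComplex]
    have h1 := (hC₂ (u • ξ)).trans (mul_le_mul_of_nonneg_right hC2 (Real.exp_pos _).le)
    refine (mul_le_mul_of_nonneg_right h1 (Real.exp_pos _).le).trans ?_
    rw [mul_assoc, ← Real.exp_add]
    refine mul_le_mul_of_nonneg_left (Real.exp_le_exp.2 (le_of_eq ?_)) hC0
    rw [norm_smul, Real.norm_eq_abs, mul_pow, sq_abs, Complex.ofReal_re, Complex.ofReal_im]
    ring
  have hbdd : ∀ w, ‖k w‖ ≤ C := by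
    intro w
    -- For every `ε > 0` Phragmén–Lindelöf gives `C exp(ε|w|²)` with the same `C`, so `ε → 0` bounds
    -- `k` by `C`.
    have hlim : Tendsto (fun ε : ℝ => C * Real.exp (ε * ‖w‖ ^ 2)) (nhdsWithin 0 (Set.Ioi 0))
        (nhds C) := by
      have : Continuous fun ε : ℝ => C * Real.exp (ε * ‖w‖ ^ 2) := by fun_prop
      simpa using (this.tendsto 0).mono_left nhdsWithin_le_nhds
    refine ge_of_tendsto hlim ?_
    filter_upwards [self_mem_nhdsWithin] with ε hε
    obtain ⟨δ, hδ, hPL⟩ := exists_norm_le_exp_of_real_axis (K := m * N / 2) (ε := ε)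
      (by positivity) hε
    refine hPL C k hkd (fun w => ?_) (fun u => ?_) w
    · rw [hk]
      simp only
      rw [norm_mul, norm_cexp_mul_sq]
      have h1 := (hC₁ w ξ).trans (mul_le_mul_of_nonneg_right hC1 (Real.exp_pos _).le)
      refine (mul_le_mul_of_nonneg_right h1 (Real.exp_pos _).le).trans ?_
      rw [mul_assoc, ← Real.exp_add]
      refine mul_le_mul_of_nonneg_left (Real.exp_le_exp.2 ?_) hC0
      have h7 : w.im ^ 2 * ‖ξ‖ ^ 2 / (2 * a') = (1 / a') * (w.im ^ 2 * N / 2) := by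
        rw [hN]; field_simp
      have h8 : (1 / a') * (w.im ^ 2 * N / 2) ≤ m * (w.im ^ 2 * N / 2) :=
        mul_le_mul_of_nonneg_right h5.le (by positivity)
      have h9 : 0 ≤ δ * w.im ^ 2 := by positivity
      rw [h7]
      linarith
    · refine (hkreal u).trans (mul_le_mul_of_nonneg_left (Real.exp_le_exp.2 ?_) hC0)
      have h7 : 0 ≤ (b' - m) * N / 2 := by have := sub_pos.2 h6; positivity
      nlinarith [sq_nonneg u]
  have hconst : ∀ w, k w = k 1 := fun w =>
    hkd.apply_eq_apply_of_bounded
      ((isBounded_iff_forall_norm_le).2 ⟨C, by rintro _ ⟨w, rfl⟩; exact hbdd w⟩) w 1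
  have hk1 : k 1 = 0 := by
    have hlim : Tendsto (fun u : ℝ => C * Real.exp (-((b' - m) * N / 2) * u ^ 2)) atTop
        (nhds 0) := by
      rw [← mul_zero C]
      refine (Real.tendsto_exp_atBot.comp ?_).const_mul C
      refine (tendsto_pow_atTop two_ne_zero).const_mul_atTop_of_neg ?_
      have := mul_pos (sub_pos.2 h6) hN0
      linarith
    have h10 : ‖k 1‖ ≤ 0 := ge_of_tendsto hlim
      (Eventually.of_forall fun u => by rw [← hconst u]; exact hkreal u)
    exact norm_le_zero_iff.1 h10
  have h11 : fourierExt f (toComplex ξ) * Complex.exp ((m * N / 2 : ℝ) * 1 ^ 2) = 0 := by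
    simpa [hk] using hk1
  rw [← fourierExt_toComplex]
  exact (mul_eq_zero.1 h11).resolve_right (Complex.exp_ne_zero _)

/-! ### Consequences of the decay condition -/

theorem integrable_exp_neg_mul_norm_sq {c : ℝ} (hc : 0 < c) :
    Integrable fun x : EuclideanSpace ℝ (Fin n) => Real.exp (-(c * ‖x‖ ^ 2 / 2)) := by
  have h := (GaussianFourier.integrable_cexp_neg_mul_sq_norm_add (V := EuclideanSpace ℝ (Fin n))
    (b := ((c / 2 : ℝ) : ℂ)) (by simpa using hc) 0 0).norm
  refine h.congr (Eventually.of_forall fun x => ?_)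
  simp only
  rw [Complex.norm_exp]
  congr 1
  simp only [zero_mul, add_zero]
  rw [← Complex.ofReal_neg, ← Complex.ofReal_pow, ← Complex.ofReal_mul, Complex.ofReal_re]
  ring

theorem exists_forall_norm_le_exp {a a' : ℝ} (ha : a' < a) {P : EuclideanSpace ℝ (Fin n) → ℝ}
    {f : EuclideanSpace ℝ (Fin n) → ℂ} (hP : logGrowth P = 0)
    (hf : ∀ x, ‖f x‖ ≤ P x * Real.exp (-(a * ‖x‖ ^ 2 / 2))) :
    ∃ R, ∀ x, R < ‖x‖ → ‖f x‖ ≤ Real.exp (-(a' * ‖x‖ ^ 2 / 2)) := by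
  have h1 := eventually_le_exp_of_logGrowth_eq_zero hP (ε := (a - a') / 2) (by linarith)
  obtain ⟨R, -, hR⟩ := (hasBasis_cobounded_norm (E := EuclideanSpace ℝ (Fin n))).eventually_iff.1 h1
  refine ⟨R, fun x hx => ?_⟩
  refine (hf x).trans ((mul_le_mul_of_nonneg_right (hR hx.le) (Real.exp_pos _).le).trans ?_)
  rw [← Real.exp_add]
  exact Real.exp_le_exp.2 (le_of_eq (by ring))

/-- A globally bounded function with Gaussian decay at infinity has Gaussian decay. -/
theorem exists_forall_norm_le_mul_exp {a M R : ℝ} (ha : 0 < a)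
    {f : EuclideanSpace ℝ (Fin n) → ℂ} (hM : ∀ x, ‖f x‖ ≤ M)
    (hR : ∀ x, R < ‖x‖ → ‖f x‖ ≤ Real.exp (-(a * ‖x‖ ^ 2 / 2))) :
    ∃ C, ∀ x, ‖f x‖ ≤ C * Real.exp (-(a * ‖x‖ ^ 2 / 2)) := by
  have hM0 : 0 ≤ M := (norm_nonneg _).trans (hM 0)
  refine ⟨M * Real.exp (a * R ^ 2 / 2) + 1, fun x => ?_⟩
  rw [add_mul, one_mul, mul_assoc, ← Real.exp_add]
  rcases le_or_gt ‖x‖ R with h | h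
  · refine (hM x).trans (le_add_of_le_of_nonneg ?_ (Real.exp_pos _).le)
    refine le_mul_of_one_le_right hM0 (Real.one_le_exp ?_)
    have := pow_le_pow_left₀ (norm_nonneg x) h 2
    nlinarith
  · exact (hR x h).trans (le_add_of_nonneg_left (by positivity))

theorem norm_fourier_le (f : EuclideanSpace ℝ (Fin n) → ℂ) (ξ : EuclideanSpace ℝ (Fin n)) :
    ‖fourier f ξ‖ ≤ (2 * Real.pi) ^ (-(n : ℝ) / 2) * ∫ x, ‖f x‖ := by
  rw [fourier, norm_mul, Complex.norm_real, Real.norm_of_nonneg (by positivity)]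
  refine mul_le_mul_of_nonneg_left ((norm_integral_le_integral_norm _).trans (le_of_eq ?_))
    (by positivity)
  congr 1
  ext x
  rw [norm_mul, mul_comm (-Complex.I), ← mul_neg_one Complex.I, mul_left_comm, Complex.norm_exp]
  simp

/-- Far out, a slightly smaller rate absorbs `P` and `Q`. On a ball they give no control; there
integrability of `f` and the `L¹` bound on `f̂` take over. -/
theorem Condition.gaussianDecay {a b : ℝ} {P Q : EuclideanSpace ℝ (Fin n) → ℝ}
    {f : EuclideanSpace ℝ (Fin n) → ℂ} (hf : Condition a b P Q f) : GaussianDecay a b f := by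
  refine ⟨hf.integrable, fun a' h0 h1 => ?_, fun b' h0 h1 => ?_⟩
  · obtain ⟨a₁, h2, h3⟩ := exists_between h1
    obtain ⟨R, hR⟩ := exists_forall_norm_le_exp h3 hf.logGrowth_left hf.bound
    have hc : 0 < a₁ - a' := sub_pos.2 h2
    refine ((hf.integrable.norm.const_mul (Real.exp (a' * R ^ 2 / 2))).add
      (integrable_exp_neg_mul_norm_sq hc)).mono' ?_ (Eventually.of_forall fun x => ?_)
    · exact (Continuous.aestronglyMeasurable (by fun_prop)).mul
        hf.integrable.aestronglyMeasurable.norm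
    · rw [Real.norm_of_nonneg (by positivity), Pi.add_apply]
      rcases le_or_gt ‖x‖ R with h | h
      · refine le_add_of_le_of_nonneg (mul_le_mul_of_nonneg_right (Real.exp_le_exp.2 ?_)
          (norm_nonneg _)) (Real.exp_pos _).le
        gcongr
      · refine le_add_of_nonneg_of_le (by positivity) ?_
        refine (mul_le_mul_of_nonneg_left (hR x h) (Real.exp_pos _).le).trans ?_
        rw [← Real.exp_add]
        exact Real.exp_le_exp.2 (le_of_eq (by ring))
  · obtain ⟨R, hR⟩ := exists_forall_norm_le_exp h1 hf.logGrowth_right hf.bound_fourier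
    exact exists_forall_norm_le_mul_exp h0 (norm_fourier_le f) hR

theorem GaussianDecay.continuous_fourier {a b : ℝ} (ha : 0 < a)
    {f : EuclideanSpace ℝ (Fin n) → ℂ} (hf : GaussianDecay a b f) : Continuous (fourier f) := by
  have h : fourier f = fourierExt f ∘ toComplex := funext fun ξ => (fourierExt_toComplex f ξ).symm
  rw [h]
  exact (hf.differentiable ha).continuous.comp continuous_toComplex

theorem GaussianDecay.integrable_exp_mul_fourier {a b : ℝ} (ha : 0 < a)
    {f : EuclideanSpace ℝ (Fin n) → ℂ} (hf : GaussianDecay a b f) {b' : ℝ} (h0 : 0 ≤ b')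
    (h1 : b' < b) : Integrable fun x => Real.exp (b' * ‖x‖ ^ 2 / 2) * ‖fourier f x‖ := by
  have hc := hf.continuous_fourier ha
  obtain ⟨b₁, h2, h3⟩ := exists_between h1
  obtain ⟨C, hC⟩ := hf.bound_fourier b₁ (h0.trans_lt h2) h3
  refine ((integrable_exp_neg_mul_norm_sq (sub_pos.2 h2)).const_mul C).mono'
    (Continuous.aestronglyMeasurable (by fun_prop)) (Eventually.of_forall fun x => ?_)
  rw [Real.norm_of_nonneg (by positivity)]
  refine (mul_le_mul_of_nonneg_left (hC x) (Real.exp_pos _).le).trans ?_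
  rw [mul_left_comm, ← Real.exp_add]
  exact le_of_eq (by ring_nf)

theorem GaussianDecay.integrable_fourier {a b : ℝ} (ha : 0 < a) (hb : 0 < b)
    {f : EuclideanSpace ℝ (Fin n) → ℂ} (hf : GaussianDecay a b f) : Integrable (fourier f) := by
  have h := hf.integrable_exp_mul_fourier ha le_rfl hb
  simp only [zero_mul, zero_div, Real.exp_zero, one_mul] at h
  exact (integrable_norm_iff (hf.continuous_fourier ha).aestronglyMeasurable).1 h

/-- This exchanges the roles of `f` and `f̂`. Inversion gives `f(-x)` only almost everywhere, so the
pointwise bound on the second transform is recovered from its continuity. -/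
theorem Condition.gaussianDecay_fourier {a b : ℝ} (ha : 0 < a) (hb : 0 < b)
    {P Q : EuclideanSpace ℝ (Fin n) → ℝ} {f : EuclideanSpace ℝ (Fin n) → ℂ}
    (hf : Condition a b P Q f) : GaussianDecay b a (fourier f) := by
  have hd := hf.gaussianDecay
  have hi := hd.integrable_fourier ha hb
  have hfirst : ∀ b', 0 < b' → b' < b →
      Integrable fun x => Real.exp (b' * ‖x‖ ^ 2 / 2) * ‖fourier f x‖ := fun b' h0 h1 =>
    hd.integrable_exp_mul_fourier ha h0.le h1
  refine ⟨hi, hfirst, fun a' h0 h1 => ?_⟩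
  -- The rate `0` makes the bound on the second transform, which is still to be proved, vacuous.
  have hcont : Continuous (fourier (fourier f)) :=
    GaussianDecay.continuous_fourier (a := b) (b := 0) hb
      ⟨hi, hfirst, fun b' h h' => absurd h h'.not_gt⟩
  obtain ⟨R, hR⟩ := exists_forall_norm_le_exp h1 hf.logGrowth_left hf.bound
  refine exists_forall_norm_le_mul_exp (R := R) h0 (norm_fourier_le (fourier f)) ?_
  have hneg : ∀ᵐ x, f (-x) = fourier (fourier f) x := by
    have h := (Measure.measurePreserving_neg
      (volume : Measure (EuclideanSpace ℝ (Fin n)))).quasiMeasurePreserving.ae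
      (ae_eq_fourier_fourier_neg hf.integrable hi)
    simpa using h
  have hopen : IsOpen {x : EuclideanSpace ℝ (Fin n) | R < ‖x‖} :=
    isOpen_lt continuous_const continuous_norm
  -- Written as `max u v = v`, the inequality becomes an almost everywhere equality of continuous
  -- functions on an open set, hence an equality at every point of it.
  have heq := Measure.eqOn_open_of_ae_eq (μ := (volume : Measure (EuclideanSpace ℝ (Fin n))))
    (f := fun x => max ‖fourier (fourier f) x‖ (Real.exp (-(a' * ‖x‖ ^ 2 / 2))))
    (g := fun x => Real.exp (-(a' * ‖x‖ ^ 2 / 2))) (U := {x | R < ‖x‖}) ?_ hopen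
    (by fun_prop) (by fun_prop)
  · intro x hx
    exact max_eq_right_iff.1 (heq hx)
  · refine (ae_restrict_iff' hopen.measurableSet).2 ?_
    filter_upwards [hneg] with x hx hxR
    rw [max_eq_right_iff, ← hx]
    simpa using hR (-x) (by simpa using hxR)

theorem maxModulus_comp_neg (F : EuclideanSpace ℂ (Fin n) → ℂ) :
    maxModulus (fun z => F (-z)) = maxModulus F := by
  ext r
  refine (Equiv.neg (EuclideanSpace ℂ (Fin n))).iSup_congr fun z => ?_
  simp

theorem IsEntireMinimalType.comp_neg {F : EuclideanSpace ℂ (Fin n) → ℂ}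
    (hF : IsEntireMinimalType F) : IsEntireMinimalType fun z => F (-z) := by
  have ht : ∀ ρ, growthType ρ (fun z => F (-z)) = growthType ρ F := fun ρ => by
    simp only [growthType, maxModulus_comp_neg]
  refine ⟨hF.entire.comp differentiable_id.neg, ?_, (ht 2).trans_le hF.type_le⟩
  have := hF.order_le
  simpa only [growthOrder, ht] using this

theorem sq_neg (z : EuclideanSpace ℂ (Fin n)) : sq (-z) = sq z := by
  simp [sq]

/-- The case `ab > 1`. -/
theorem Condition.ae_eq_zero (hn : 1 ≤ n) {a b : ℝ} (ha : 0 < a) (hb : 0 < b) (hab : 1 < a * b)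
    {P Q : EuclideanSpace ℝ (Fin n) → ℝ} {f : EuclideanSpace ℝ (Fin n) → ℂ}
    (hf : Condition a b P Q f) : f =ᵐ[volume] 0 := by
  have : Nonempty (Fin n) := ⟨⟨0, hn⟩⟩
  have hd := hf.gaussianDecay
  have hae : fourier f =ᵐ[volume] 0 := by
    filter_upwards [compl_mem_ae_iff.2
      (measure_singleton (μ := volume) (0 : EuclideanSpace ℝ (Fin n)))] with ξ hξ
    exact hd.fourier_eq_zero ha hb hab ξ hξ
  filter_upwards [ae_eq_fourier_fourier_neg hf.integrable (hd.integrable_fourier ha hb)] with x hx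
  rw [hx, fourier, integral_congr_ae (g := 0), integral_zero', mul_zero]
  · rfl
  · filter_upwards [hae] with ξ hξ
    simp [hξ]

/-- The case `ab = 1`. -/
theorem Condition.exists_entire {a b : ℝ} (ha : 0 < a) (hb : 0 < b) (hab : a * b = 1)
    {P Q : EuclideanSpace ℝ (Fin n) → ℝ} {f : EuclideanSpace ℝ (Fin n) → ℂ}
    (hf : Condition a b P Q f) :
    ∃ F G R S : EuclideanSpace ℂ (Fin n) → ℂ,
      Differentiable ℂ F ∧ Differentiable ℂ G ∧
      (∀ᵐ x, f x = F (toComplex x)) ∧ (∀ ξ, fourier f ξ = G (toComplex ξ)) ∧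
      IsEntireMinimalType R ∧ IsEntireMinimalType S ∧
      (∀ z, F z = R z * Complex.exp (-((a : ℂ) * sq z / 2))) ∧
      (∀ z, G z = S z * Complex.exp (-(sq z / (2 * (a : ℂ))))) := by
  have hd := hf.gaussianDecay
  have hd' := hf.gaussianDecay_fourier ha hb
  have hb' : b = 1 / a := by field_simp; linarith
  have ha' : a = 1 / b := by field_simp; linarith
  have hS := GaussianDecay.isEntireMinimalType ha (hb' ▸ hd)
  have hT := GaussianDecay.isEntireMinimalType hb (f := fourier f) (by rw [← ha']; exact hd')
  -- Inversion evaluates the second transform at `-x`, which explains the sign; the exponent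
  -- `1/(2b)` is `a/2`.
  refine ⟨fun z => fourierExt (fourier f) (-z), fourierExt f,
    fun z => fourierExt (fourier f) (-z) * Complex.exp (sq (-z) / (2 * (b : ℂ))),
    fun z => fourierExt f z * Complex.exp (sq z / (2 * (a : ℂ))),
    (hd'.differentiable hb).comp differentiable_id.neg, hd.differentiable ha, ?_,
    fun ξ => (fourierExt_toComplex f ξ).symm, hT.comp_neg, hS, fun z => ?_, fun z => ?_⟩
  · filter_upwards [ae_eq_fourier_fourier_neg hf.integrable hd'.integrable] with x hx
    have h : -toComplex x = toComplex (-x) := by ext j; simp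
    rw [hx, h, fourierExt_toComplex]
  · have hac : (a : ℂ) = 1 / (b : ℂ) := by rw [ha']; simp
    have hbc : (b : ℂ) ≠ 0 := by exact_mod_cast hb.ne'
    have h : sq (-z) / (2 * (b : ℂ)) = (a : ℂ) * sq z / 2 := by
      rw [sq_neg, hac]; field_simp
    simp only
    rw [h, mul_assoc, ← Complex.exp_add, add_neg_cancel, Complex.exp_zero, mul_one]
  · rw [mul_assoc, ← Complex.exp_add, add_neg_cancel, Complex.exp_zero, mul_one]

/-! ### Polynomials times Gaussians on the line -/

/-- Combine `|t|^k ≤ 1 + t^{2k}` with one term of the exponential series at `εt²`. -/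
theorem abs_pow_le_mul_exp {ε : ℝ} (hε : 0 < ε) (k : ℕ) (t : ℝ) :
    |t| ^ k ≤ (1 + k.factorial / ε ^ k) * Real.exp (ε * t ^ 2) := by
  have h1 : |t| ^ k ≤ 1 + (t ^ 2) ^ k := by
    rw [← sq_abs, ← pow_mul, mul_comm 2 k, pow_mul]
    nlinarith [sq_nonneg (|t| ^ k - 1)]
  have h2 : (t ^ 2) ^ k ≤ k.factorial / ε ^ k * Real.exp (ε * t ^ 2) := by
    have h3 := Real.pow_div_factorial_le_exp (ε * t ^ 2) (by positivity) k
    rw [div_le_iff₀ (by positivity), mul_pow] at h3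
    rw [div_mul_eq_mul_div, le_div_iff₀ (by positivity)]
    linarith
  have h4 : 1 ≤ Real.exp (ε * t ^ 2) := Real.one_le_exp (by positivity)
  rw [add_mul, one_mul]
  linarith

theorem exists_norm_eval_le_mul_exp (p : Polynomial ℂ) {ε : ℝ} (hε : 0 < ε) :
    ∃ C, ∀ t : ℝ, ‖p.eval (t : ℂ)‖ ≤ C * Real.exp (ε * t ^ 2) := by
  induction p using Polynomial.induction_on' with
  | add p q hp hq =>
    obtain ⟨C, hC⟩ := hp
    obtain ⟨D, hD⟩ := hq
    refine ⟨C + D, fun t => ?_⟩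
    rw [Polynomial.eval_add, add_mul]
    exact (norm_add_le _ _).trans (add_le_add (hC t) (hD t))
  | monomial k z =>
    refine ⟨‖z‖ * (1 + k.factorial / ε ^ k), fun t => ?_⟩
    rw [Polynomial.eval_monomial, norm_mul, norm_pow, Complex.norm_real, Real.norm_eq_abs,
      mul_assoc]
    exact mul_le_mul_of_nonneg_left (abs_pow_le_mul_exp hε k t) (norm_nonneg _)

theorem integrable_eval_mul_exp (p : Polynomial ℂ) {β : ℝ} (hβ : 0 < β) :
    Integrable fun t : ℝ => p.eval (t : ℂ) * Complex.exp (-(β : ℂ) * (t : ℂ) ^ 2) := by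
  obtain ⟨C, hC⟩ := exists_norm_eval_le_mul_exp p (half_pos hβ)
  refine ((integrable_exp_neg_mul_sq (half_pos hβ)).const_mul C).mono'
    (Continuous.aestronglyMeasurable ?_) (Eventually.of_forall fun t => ?_)
  · have := p.continuous
    fun_prop
  · have h1 : ‖Complex.exp (-(β : ℂ) * (t : ℂ) ^ 2)‖ = Real.exp (-β * t ^ 2) := by
      rw [← Complex.ofReal_neg, ← Complex.ofReal_pow, ← Complex.ofReal_mul, Complex.norm_exp,
        Complex.ofReal_re]
    rw [norm_mul, h1]
    refine (mul_le_mul_of_nonneg_right (hC t) (Real.exp_pos _).le).trans (le_of_eq ?_)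
    rw [mul_assoc, ← Real.exp_add]
    ring_nf

/-- Differentiation acts on the polynomial factor by `p ↦ p' - 2βXp`. -/
theorem exists_iteratedDeriv_cexp (A : ℂ) (β : ℝ) (k : ℕ) :
    ∃ p : Polynomial ℂ, iteratedDeriv k (fun s : ℝ => A * Complex.exp (-(β : ℂ) * (s : ℂ) ^ 2)) =
      fun t : ℝ => p.eval (t : ℂ) * Complex.exp (-(β : ℂ) * (t : ℂ) ^ 2) := by
  induction k with
  | zero => exact ⟨Polynomial.C A, by simp⟩
  | succ k ih =>
    obtain ⟨p, hp⟩ := ih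
    refine ⟨p.derivative - Polynomial.C (2 * (β : ℂ)) * Polynomial.X * p, ?_⟩
    rw [iteratedDeriv_succ, hp]
    ext t
    have h0 : HasDerivAt (fun s : ℂ => -(β : ℂ) * s ^ 2) (-(β : ℂ) * (2 * (t : ℂ))) (t : ℂ) := by
      simpa using (hasDerivAt_pow 2 (t : ℂ)).const_mul (-(β : ℂ))
    refine ((p.hasDerivAt (t : ℂ)).mul h0.cexp).comp_ofReal.deriv.trans ?_
    simp
    ring

theorem exists_iteratedDeriv_exp (k : ℕ) :
    ∃ p : Polynomial ℝ, iteratedDeriv k (fun s : ℝ => Real.exp (-s ^ 2)) =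
      fun t : ℝ => p.eval t * Real.exp (-t ^ 2) := by
  induction k with
  | zero => exact ⟨Polynomial.C 1, by simp⟩
  | succ k ih =>
    obtain ⟨p, hp⟩ := ih
    refine ⟨p.derivative - Polynomial.C 2 * Polynomial.X * p, ?_⟩
    rw [iteratedDeriv_succ, hp]
    ext t
    have h0 : HasDerivAt (fun s : ℝ => -s ^ 2) (-(2 * t)) t := by
      simpa using (hasDerivAt_pow 2 t).fun_neg
    refine ((p.hasDerivAt t).mul h0.exp).deriv.trans ?_
    simp
    ring

-- The factor `t^k` turns into a `k`-th derivative of the transformed Gaussian. Dividing by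
-- `(-2πi)^k` and evaluating at `ξ/(2π)` accounts for the normalization of `𝓕`.
open scoped FourierTransform in
theorem exists_fourierIntegral_monomial {γ : ℝ} (hγ : 0 < γ) (k : ℕ) :
    ∃ r : Polynomial ℂ, ∀ ξ : ℝ,
      ∫ t : ℝ, Complex.exp (-Complex.I * ((t * ξ : ℝ) : ℂ)) *
        ((t : ℂ) ^ k * Complex.exp (-((γ / 2 : ℝ) : ℂ) * (t : ℂ) ^ 2)) =
      r.eval (ξ : ℂ) * Complex.exp (-((ξ ^ 2 / (2 * γ) : ℝ) : ℂ)) := by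
  have hpi : (Real.pi : ℂ) ≠ 0 := by exact_mod_cast Real.pi_ne_zero
  have hγc : (γ : ℂ) ≠ 0 := by exact_mod_cast hγ.ne'
  set g : ℝ → ℂ := fun t => Complex.exp (-((γ / 2 : ℝ) : ℂ) * (t : ℂ) ^ 2) with hg
  have hFg : 𝓕 g = fun w : ℝ => ((Real.pi : ℂ) / ((γ / 2 : ℝ) : ℂ)) ^ (1 / 2 : ℂ) *
      Complex.exp (-((2 * Real.pi ^ 2 / γ : ℝ) : ℂ) * (w : ℂ) ^ 2) := by
    ext w
    have h := fourier_gaussian_innerProductSpace (V := ℝ) (b := ((γ / 2 : ℝ) : ℂ))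
      (by simpa using hγ) w
    have hn : ∀ v : ℝ, ((‖v‖ : ℝ) : ℂ) ^ 2 = (v : ℂ) ^ 2 := fun v => by
      rw [← Complex.ofReal_pow, Real.norm_eq_abs, sq_abs, Complex.ofReal_pow]
    simp only [hn] at h
    rw [hg, h]
    congr 1
    · simp
    · congr 1
      push_cast
      field_simp
  have hint : ∀ m : ℕ, (m : ℕ∞) ≤ (⊤ : ℕ∞) → Integrable fun x : ℝ => x ^ m • g x := by
    intro m _
    have h := integrable_eval_mul_exp (Polynomial.X ^ m) (half_pos hγ)
    simpa [hg] using h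
  have hD := Real.iteratedDeriv_fourier (f := g) (N := ⊤) (n := k) hint le_top
  obtain ⟨p, hp⟩ := exists_iteratedDeriv_cexp
    (((Real.pi : ℂ) / ((γ / 2 : ℝ) : ℂ)) ^ (1 / 2 : ℂ)) (2 * Real.pi ^ 2 / γ) k
  rw [hFg, hp] at hD
  refine ⟨Polynomial.C ((-2 * Real.pi * Complex.I) ^ k)⁻¹ *
    p.comp (Polynomial.C (2 * (Real.pi : ℂ))⁻¹ * Polynomial.X), fun ξ => ?_⟩
  have hD' := congrFun hD ((2 * Real.pi)⁻¹ * ξ)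
  rw [Real.fourier_real_eq_integral_exp_smul] at hD'
  have hne : (-2 * (Real.pi : ℂ) * Complex.I) ^ k ≠ 0 :=
    pow_ne_zero _ (mul_ne_zero (mul_ne_zero (by norm_num) hpi) Complex.I_ne_zero)
  have h1 : ∀ t : ℝ, Complex.exp (((-2 * Real.pi * t * ((2 * Real.pi)⁻¹ * ξ) : ℝ) : ℂ) *
      Complex.I) • ((-2 * (Real.pi : ℂ) * Complex.I * (t : ℂ)) ^ k • g t) =
      (-2 * (Real.pi : ℂ) * Complex.I) ^ k * (Complex.exp (-Complex.I * ((t * ξ : ℝ) : ℂ)) *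
        ((t : ℂ) ^ k * g t)) := by
    intro t
    rw [smul_eq_mul, smul_eq_mul, mul_pow]
    have h2 : ((-2 * Real.pi * t * ((2 * Real.pi)⁻¹ * ξ) : ℝ) : ℂ) * Complex.I =
        -Complex.I * ((t * ξ : ℝ) : ℂ) := by
      push_cast
      field_simp
    rw [h2]
    ring
  simp only [h1] at hD'
  rw [integral_const_mul] at hD'
  have h3 : -((2 * Real.pi ^ 2 / γ : ℝ) : ℂ) * (((2 * Real.pi)⁻¹ * ξ : ℝ) : ℂ) ^ 2 =
      -((ξ ^ 2 / (2 * γ) : ℝ) : ℂ) := by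
    push_cast
    field_simp
  rw [h3] at hD'
  simp only [Polynomial.eval_mul, Polynomial.eval_C, Polynomial.eval_comp, Polynomial.eval_X]
  rw [mul_assoc, eq_inv_mul_iff_mul_eq₀ hne, ← hD']
  push_cast
  rfl

/-- The Fourier transform of a polynomial times a Gaussian is of the same form. -/
theorem exists_fourierIntegral_eval_mul_exp {γ : ℝ} (hγ : 0 < γ) (q : Polynomial ℂ) :
    ∃ r : Polynomial ℂ, ∀ ξ : ℝ,
      ∫ t : ℝ, Complex.exp (-Complex.I * ((t * ξ : ℝ) : ℂ)) *
        (q.eval (t : ℂ) * Complex.exp (-((γ / 2 : ℝ) : ℂ) * (t : ℂ) ^ 2)) =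
      r.eval (ξ : ℂ) * Complex.exp (-((ξ ^ 2 / (2 * γ) : ℝ) : ℂ)) := by
  induction q using Polynomial.induction_on' with
  | add p q hp hq =>
    obtain ⟨r, hr⟩ := hp
    obtain ⟨s, hs⟩ := hq
    refine ⟨r + s, fun ξ => ?_⟩
    have hi : ∀ p : Polynomial ℂ, Integrable fun t : ℝ =>
        Complex.exp (-Complex.I * ((t * ξ : ℝ) : ℂ)) *
          (p.eval (t : ℂ) * Complex.exp (-((γ / 2 : ℝ) : ℂ) * (t : ℂ) ^ 2)) := by
      intro p
      refine (integrable_eval_mul_exp p (half_pos hγ)).bdd_mul (c := 1)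
        (Continuous.aestronglyMeasurable (by fun_prop)) (Eventually.of_forall fun t => ?_)
      rw [Complex.norm_exp]
      simp
    rw [Polynomial.eval_add, add_mul, ← hr, ← hs, ← integral_add (hi p) (hi q)]
    congr 1
    ext t
    rw [Polynomial.eval_add]
    ring
  | monomial k z =>
    obtain ⟨r, hr⟩ := exists_fourierIntegral_monomial hγ k
    refine ⟨Polynomial.C z * r, fun ξ => ?_⟩
    rw [Polynomial.eval_mul, Polynomial.eval_C, mul_assoc, ← hr, ← integral_const_mul]
    congr 1
    ext t
    rw [Polynomial.eval_monomial]
    ring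

/-! ### Products of polynomials and Gaussians -/

theorem exists_one_add_mul_prod_le (p : Fin n → Polynomial ℂ) {A : ℝ} (hA : 0 ≤ A) {ε : ℝ}
    (hε : 0 < ε) : ∃ C, ∀ x : EuclideanSpace ℝ (Fin n),
      1 + A * ∏ j, ‖(p j).eval (x j : ℂ)‖ ≤ C * Real.exp (ε * ‖x‖ ^ 2) := by
  choose C hC using fun j => exists_norm_eval_le_mul_exp (p j) hε
  refine ⟨1 + A * ∏ j, C j, fun x => ?_⟩
  have h1 : ∏ j, ‖(p j).eval (x j : ℂ)‖ ≤ (∏ j, C j) * Real.exp (ε * ‖x‖ ^ 2) := by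
    rw [EuclideanSpace.norm_sq_eq, Finset.mul_sum, Real.exp_sum, ← Finset.prod_mul_distrib]
    refine Finset.prod_le_prod (fun j _ => norm_nonneg _) fun j _ => ?_
    simpa using hC j (x j)
  have h2 : 1 ≤ Real.exp (ε * ‖x‖ ^ 2) := Real.one_le_exp (by positivity)
  rw [add_mul, one_mul, mul_assoc]
  exact add_le_add h2 (mul_le_mul_of_nonneg_left h1 hA)

theorem logGrowth_one_add_mul_prod (hn : 1 ≤ n) (p : Fin n → Polynomial ℂ) {A : ℝ}
    (hA : 0 ≤ A) :
    logGrowth (fun x : EuclideanSpace ℝ (Fin n) => 1 + A * ∏ j, ‖(p j).eval (x j : ℂ)‖) = 0 :=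
  logGrowth_eq_zero hn
    (fun _ => le_add_of_nonneg_right (mul_nonneg hA (Finset.prod_nonneg fun _ _ => norm_nonneg _)))
    fun _ hε => exists_one_add_mul_prod_le p hA hε

theorem prod_cexp_neg_mul_sq (β : ℝ) (x : EuclideanSpace ℝ (Fin n)) :
    ∏ j, Complex.exp (-(β : ℂ) * (x j : ℂ) ^ 2) = (Real.exp (-(β * ‖x‖ ^ 2)) : ℂ) := by
  rw [← Complex.exp_sum, Complex.ofReal_exp, EuclideanSpace.norm_sq_eq, ← Finset.mul_sum]
  simp

theorem fourier_prod (h : Fin n → ℝ → ℂ) (ξ : EuclideanSpace ℝ (Fin n)) :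
    fourier (fun x => ∏ j, h j (x j)) ξ = (((2 * Real.pi) ^ (-(n : ℝ) / 2) : ℝ) : ℂ) *
      ∏ j, ∫ t : ℝ, Complex.exp (-Complex.I * ((t * ξ j : ℝ) : ℂ)) * h j t := by
  rw [fourier, ← integral_fintype_prod_volume_eq_prod,
    ← (PiLp.volume_preserving_toLp (Fin n)).integral_comp
      (MeasurableEquiv.toLp 2 _).measurableEmbedding]
  congr 2
  ext v
  rw [Finset.prod_mul_distrib, ← Complex.exp_sum, ← Finset.mul_sum]
  congr 3
  simp [PiLp.inner_apply, mul_comm]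

/-- The rate becomes `1/γ ≥ b` under the transform, and the polynomial factors on both sides go into
`P` and `Q`. -/
theorem exists_condition_prod (hn : 1 ≤ n) {a b γ : ℝ} (ha : 0 < a) (haγ : a ≤ γ)
    (hbγ : b * γ ≤ 1) (q : Fin n → Polynomial ℂ) :
    ∃ P Q, Condition a b P Q fun x : EuclideanSpace ℝ (Fin n) =>
      ∏ j, ((q j).eval (x j : ℂ) * Complex.exp (-((γ / 2 : ℝ) : ℂ) * (x j : ℂ) ^ 2)) := by
  have hγ : 0 < γ := ha.trans_le haγ
  choose r hr using fun j => exists_fourierIntegral_eval_mul_exp hγ (q j)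
  set κ : ℝ := (2 * Real.pi) ^ (-(n : ℝ) / 2) with hκ
  have hκ0 : 0 ≤ κ := by positivity
  have hnorm : ∀ x : EuclideanSpace ℝ (Fin n),
      ‖∏ j, ((q j).eval (x j : ℂ) * Complex.exp (-((γ / 2 : ℝ) : ℂ) * (x j : ℂ) ^ 2))‖ =
        (∏ j, ‖(q j).eval (x j : ℂ)‖) * Real.exp (-(γ / 2 * ‖x‖ ^ 2)) := by
    intro x
    rw [Finset.prod_mul_distrib, prod_cexp_neg_mul_sq, norm_mul, norm_prod, Complex.norm_real,
      Real.norm_of_nonneg (Real.exp_pos _).le]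
  -- Adding `1` makes the growth exactly `0`, even where polynomials vanish.
  refine ⟨fun x => 1 + 1 * ∏ j, ‖(q j).eval (x j : ℂ)‖,
    fun ξ => 1 + κ * ∏ j, ‖(r j).eval (ξ j : ℂ)‖, ?_, fun x => ?_, fun ξ => ?_,
    logGrowth_one_add_mul_prod hn q zero_le_one, logGrowth_one_add_mul_prod hn r hκ0⟩
  · obtain ⟨C, hC⟩ := exists_one_add_mul_prod_le q zero_le_one (ε := γ / 4) (by positivity)
    refine ((integrable_exp_neg_mul_norm_sq (half_pos hγ)).const_mul C).mono'
      (Continuous.aestronglyMeasurable ?_) (Eventually.of_forall fun x => ?_)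
    · have := fun j => (q j).continuous
      fun_prop
    · rw [hnorm]
      have h1 := hC x
      refine (mul_le_mul_of_nonneg_right (show _ ≤ C * Real.exp (γ / 4 * ‖x‖ ^ 2) by linarith)
        (Real.exp_pos _).le).trans (le_of_eq ?_)
      rw [mul_assoc, ← Real.exp_add]
      ring_nf
  · rw [hnorm]
    have h1 : 0 ≤ ∏ j, ‖(q j).eval (x j : ℂ)‖ := Finset.prod_nonneg fun _ _ => norm_nonneg _
    refine mul_le_mul (by linarith) (Real.exp_le_exp.2 ?_) (Real.exp_pos _).le (by linarith)
    nlinarith [sq_nonneg ‖x‖]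
  · have h1 : 0 ≤ ∏ j, ‖(r j).eval (ξ j : ℂ)‖ := Finset.prod_nonneg fun _ _ => norm_nonneg _
    have h2 : ‖fourier (fun x : EuclideanSpace ℝ (Fin n) => ∏ j, ((q j).eval (x j : ℂ) *
        Complex.exp (-((γ / 2 : ℝ) : ℂ) * (x j : ℂ) ^ 2))) ξ‖ =
        κ * (∏ j, ‖(r j).eval (ξ j : ℂ)‖) * Real.exp (-(1 / (2 * γ) * ‖ξ‖ ^ 2)) := by
      rw [fourier_prod (fun j t => (q j).eval (t : ℂ) *
        Complex.exp (-((γ / 2 : ℝ) : ℂ) * (t : ℂ) ^ 2))]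
      simp only [hr]
      have h3 : ∀ j, Complex.exp (-((ξ j ^ 2 / (2 * γ) : ℝ) : ℂ)) =
          Complex.exp (-((1 / (2 * γ) : ℝ) : ℂ) * (ξ j : ℂ) ^ 2) := by
        intro j
        congr 1
        push_cast
        ring
      simp only [h3]
      rw [Finset.prod_mul_distrib, prod_cexp_neg_mul_sq, norm_mul, norm_mul, norm_prod,
        Complex.norm_real, Complex.norm_real, Real.norm_of_nonneg hκ0,
        Real.norm_of_nonneg (Real.exp_pos _).le, mul_assoc]
    rw [h2]
    refine mul_le_mul (by linarith) (Real.exp_le_exp.2 ?_) (Real.exp_pos _).le (by positivity)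
    have h4 : b ≤ 1 / γ := by rwa [le_div_iff₀ hγ]
    have h5 : 1 / (2 * γ) = 1 / γ / 2 := by field_simp
    rw [h5]
    nlinarith [sq_nonneg ‖ξ‖]

/-- Dilated Hermite functions satisfy the decay condition. -/
theorem exists_condition_hermiteFun (hn : 1 ≤ n) {a b c : ℝ} (ha : 0 < a) (hac : a ≤ c ^ 2)
    (hbc : b * c ^ 2 ≤ 1) (α : Fin n → ℕ) :
    ∃ P Q : EuclideanSpace ℝ (Fin n) → ℝ,
      Condition a b P Q (fun x => hermiteFun α (c • x)) := by
  choose p hp using exists_iteratedDeriv_exp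
  have h1 : ∀ (k : ℕ) (t : ℝ), hermite1 k t =
      (Real.sqrt (2 ^ k * (k.factorial : ℝ) * Real.sqrt Real.pi))⁻¹ * (-1) ^ k * (p k).eval t *
        Real.exp (-(t ^ 2 / 2)) := by
    intro k t
    rw [hermite1, hp, show -(t ^ 2 / 2) = t ^ 2 / 2 + -t ^ 2 by ring, Real.exp_add]
    ring
  -- The Gaussian factor of a Hermite function has rate `1`, so dilation by `c` gives `γ = c²`.
  obtain ⟨P, Q, h⟩ := exists_condition_prod hn ha hac hbc (fun j => (Polynomial.C
    ((Real.sqrt (2 ^ α j * ((α j).factorial : ℝ) * Real.sqrt Real.pi))⁻¹ * (-1) ^ α j) *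
      (p (α j)).comp (Polynomial.C c * Polynomial.X)).map Complex.ofRealHom)
  refine ⟨P, Q, ?_⟩
  convert h using 2 with x
  rw [hermiteFun, Complex.ofReal_prod]
  refine Finset.prod_congr rfl fun j _ => ?_
  have h2 : Complex.exp (-((c ^ 2 / 2 : ℝ) : ℂ) * (x j : ℂ) ^ 2) =
      (Real.exp (-((c * x j) ^ 2 / 2)) : ℂ) := by
    rw [Complex.ofReal_exp]
    congr 1
    push_cast
    ring
  rw [h2, h1, show ((x j : ℝ) : ℂ) = Complex.ofRealHom (x j) from rfl, Polynomial.eval_map_apply]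
  simp

/-! ### Infinitely many solutions -/

/-- Evaluated at `√t e₁`, the Gaussians become the characters `t ↦ exp(-c_k t/2)` of the additive
monoid of nonnegative reals; distinct characters are independent by Dedekind. -/
theorem linearIndependent_gaussian (hn : 1 ≤ n) {c : ℕ → ℝ} (hc : Function.Injective c) :
    LinearIndependent ℂ fun (k : ℕ) (x : EuclideanSpace ℝ (Fin n)) =>
      ∏ j, Complex.exp (-((c k / 2 : ℝ) : ℂ) * (x j : ℂ) ^ 2) := by
  let χ : ℕ → (Multiplicative NNReal →* ℂ) := fun k =>
    { toFun := fun t => (Real.exp (-(c k / 2 * (Multiplicative.toAdd t : NNReal))) : ℂ)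
      map_one' := by simp
      map_mul' := fun s t => by
        rw [← Complex.ofReal_mul, ← Real.exp_add]
        congr 2
        simp
        ring }
  have hχ : Function.Injective χ := by
    intro k l hkl
    have h := DFunLike.congr_fun hkl (Multiplicative.ofAdd (1 : NNReal))
    simp only [χ, MonoidHom.coe_mk, OneHom.coe_mk, toAdd_ofAdd, NNReal.coe_one, mul_one] at h
    have h' := Real.exp_injective (Complex.ofReal_injective h)
    exact hc (by linarith)
  have hli := (linearIndependent_monoidHom (Multiplicative NNReal) ℂ).comp χ hχ
  let T : (EuclideanSpace ℝ (Fin n) → ℂ) →ₗ[ℂ] (Multiplicative NNReal → ℂ) :=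
    LinearMap.funLeft ℂ ℂ fun t =>
      EuclideanSpace.single (⟨0, hn⟩ : Fin n) (Real.sqrt (Multiplicative.toAdd t : NNReal))
  suffices h : (T ∘ fun (k : ℕ) (x : EuclideanSpace ℝ (Fin n)) =>
      ∏ j, Complex.exp (-((c k / 2 : ℝ) : ℂ) * (x j : ℂ) ^ 2)) = fun k => ⇑(χ k) by
    refine LinearIndependent.of_comp T ?_
    rw [h]
    exact hli
  ext k t
  simp only [Function.comp_apply, T, LinearMap.funLeft_apply]
  rw [prod_cexp_neg_mul_sq, PiLp.norm_single, Real.norm_eq_abs, sq_abs,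
    Real.sq_sqrt (NNReal.coe_nonneg _)]
  rfl

/-- The explicit constant is what allows a single `Q` to serve infinitely many Gaussians. -/
theorem norm_fourier_gaussian {c : ℝ} (hc : 0 < c) (ξ : EuclideanSpace ℝ (Fin n)) :
    ‖fourier (fun x => ∏ j, Complex.exp (-((c / 2 : ℝ) : ℂ) * (x j : ℂ) ^ 2)) ξ‖ =
      (2 * Real.pi) ^ (-(n : ℝ) / 2) * (Real.pi / (c / 2)) ^ ((n : ℝ) / 2) *
        Real.exp (-(‖ξ‖ ^ 2 / (2 * c))) := by
  have h1 : (fun x : EuclideanSpace ℝ (Fin n) =>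
      ∏ j, Complex.exp (-((c / 2 : ℝ) : ℂ) * (x j : ℂ) ^ 2)) =
      fun x => Complex.exp (-((c / 2 : ℝ) : ℂ) * (‖x‖ : ℂ) ^ 2) := by
    ext x
    rw [prod_cexp_neg_mul_sq]
    simp
  rw [h1, fourier_eq_fourierIntegral, fourier_gaussian_innerProductSpace (by simpa using hc),
    norm_mul, norm_mul, Complex.norm_real, Real.norm_of_nonneg (by positivity), mul_assoc,
    ← Complex.ofReal_div, Complex.norm_cpow_eq_rpow_re_of_pos (by positivity)]
  have h2 : -(Real.pi : ℂ) ^ 2 * (‖(2 * Real.pi)⁻¹ • ξ‖ : ℂ) ^ 2 / ((c / 2 : ℝ) : ℂ) =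
      ((-(‖ξ‖ ^ 2 / (2 * c)) : ℝ) : ℂ) := by
    rw [norm_smul, Real.norm_of_nonneg (by positivity)]
    have : (Real.pi : ℂ) ≠ 0 := by exact_mod_cast Real.pi_ne_zero
    have : (c : ℂ) ≠ 0 := by exact_mod_cast hc.ne'
    push_cast
    field_simp
  rw [h2, Complex.norm_exp, Complex.ofReal_re]
  simp

/-- For `ab < 1` the Gaussians with exponents between `a` and `1 / b` are solutions. -/
theorem exists_linearIndependent_condition (hn : 1 ≤ n) {a b : ℝ} (ha : 0 < a) (hb : 0 < b)
    (hab : a * b < 1) :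
    ∃ (P Q : EuclideanSpace ℝ (Fin n) → ℝ) (g : ℕ → EuclideanSpace ℝ (Fin n) → ℂ),
      LinearIndependent ℂ g ∧ ∀ k, Continuous (g k) ∧ Condition a b P Q (g k) := by
  have hlt : a < 1 / b := by rwa [lt_div_iff₀ hb]
  have hd : 0 < 1 / b - a := sub_pos.2 hlt
  set c : ℕ → ℝ := fun k => a + (1 / b - a) / (k + 1) with hc
  have hca : ∀ k, a ≤ c k := fun k => le_add_of_nonneg_right (by positivity)
  have hcb : ∀ k, c k ≤ 1 / b := by
    intro k
    have : (1 / b - a) / ((k : ℝ) + 1) ≤ 1 / b - a :=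
      div_le_self hd.le (by linarith [(Nat.cast_nonneg k : (0 : ℝ) ≤ k)])
    simp only [hc]
    linarith
  have hinj : Function.Injective c := by
    intro k l hkl
    have h1 := add_left_cancel hkl
    rw [div_eq_div_iff (by positivity) (by positivity)] at h1
    have h2 := mul_left_cancel₀ hd.ne' h1
    exact_mod_cast (add_right_cancel h2).symm
  -- The constant of the transform decreases with the rate, so its value at `a` dominates those at
  -- all `c k ≥ a`.
  set D : ℝ := (2 * Real.pi) ^ (-(n : ℝ) / 2) * (Real.pi / (a / 2)) ^ ((n : ℝ) / 2) with hD
  have hD0 : 0 ≤ D := by positivity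
  have hconst : ∀ A : ℝ, 1 ≤ A → logGrowth (fun _ : EuclideanSpace ℝ (Fin n) => A) = 0 :=
    fun A hA => logGrowth_eq_zero hn (fun _ => hA) fun ε hε => ⟨A, fun x =>
      le_mul_of_one_le_right (by linarith) (Real.one_le_exp (by positivity))⟩
  refine ⟨fun _ => 1, fun _ => 1 + D, _, linearIndependent_gaussian hn hinj, fun k =>
    ⟨by fun_prop, ?_, fun x => ?_, fun ξ => ?_, hconst 1 le_rfl, hconst _ (by linarith)⟩⟩
  · have hck : 0 < c k := ha.trans_le (hca k)
    refine (integrable_exp_neg_mul_norm_sq hck).ofReal.congr (Eventually.of_forall fun x => ?_)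
    simp only
    rw [prod_cexp_neg_mul_sq]
    rw [show -(c k / 2 * ‖x‖ ^ 2) = -(c k * ‖x‖ ^ 2 / 2) by ring]
    rfl
  · rw [prod_cexp_neg_mul_sq, Complex.norm_real, Real.norm_of_nonneg (Real.exp_pos _).le, one_mul]
    refine Real.exp_le_exp.2 ?_
    nlinarith [sq_nonneg ‖x‖, hca k]
  · have hck : 0 < c k := ha.trans_le (hca k)
    rw [norm_fourier_gaussian hck]
    refine mul_le_mul ?_ (Real.exp_le_exp.2 ?_) (Real.exp_pos _).le (by positivity)
    · refine le_trans (mul_le_mul_of_nonneg_left (Real.rpow_le_rpow (by positivity) ?_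
        (by positivity)) (by positivity)) (show D ≤ 1 + D by linarith)
      have := hca k
      gcongr
    · have h1 : b ≤ 1 / c k := by
        rw [le_div_iff₀ hck]
        have := hcb k
        rw [le_div_iff₀ hb] at this
        linarith
      have h2 : ‖ξ‖ ^ 2 / (2 * c k) = 1 / c k * ‖ξ‖ ^ 2 / 2 := by field_simp
      rw [h2]
      nlinarith [sq_nonneg ‖ξ‖]

end Pfannschmidt

theorem theorem1p3 (n : ℕ) (hn : 1 ≤ n) (a b : ℝ) (ha : 0 < a) (hb : 0 < b) :
    (∀ (f : EuclideanSpace ℝ (Fin n) → ℂ) (P Q : EuclideanSpace ℝ (Fin n) → ℝ),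
      Pfannschmidt.Condition a b P Q f →
        (1 < a * b → f =ᵐ[volume] 0) ∧
        (a * b = 1 →
          ∃ F G R S : EuclideanSpace ℂ (Fin n) → ℂ,
            Differentiable ℂ F ∧ Differentiable ℂ G ∧
            (∀ᵐ x, f x = F (Pfannschmidt.toComplex x)) ∧
            (∀ ξ, Pfannschmidt.fourier f ξ = G (Pfannschmidt.toComplex ξ)) ∧
            Pfannschmidt.IsEntireMinimalType R ∧ Pfannschmidt.IsEntireMinimalType S ∧
            (∀ z, F z = R z * Complex.exp (-((a : ℂ) * Pfannschmidt.sq z / 2))) ∧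
            (∀ z, G z = S z * Complex.exp (-(Pfannschmidt.sq z / (2 * (a : ℂ))))))) ∧
    (a * b < 1 →
      (∃ (P Q : EuclideanSpace ℝ (Fin n) → ℝ) (g : ℕ → EuclideanSpace ℝ (Fin n) → ℂ),
        LinearIndependent ℂ g ∧
        ∀ k, Continuous (g k) ∧ Pfannschmidt.Condition a b P Q (g k)) ∧
      ∀ c : ℝ, 0 < c → a ≤ c ^ 2 → b * c ^ 2 ≤ 1 → ∀ α : Fin n → ℕ,
        ∃ P Q : EuclideanSpace ℝ (Fin n) → ℝ,
          Pfannschmidt.Condition a b P Q (fun x => Pfannschmidt.hermiteFun α (c • x))) := by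
  refine ⟨fun f P Q hf => ⟨fun hab => hf.ae_eq_zero hn ha hb hab,
    fun hab => hf.exists_entire ha hb hab⟩, fun hab => ⟨?_, ?_⟩⟩
  · exact Pfannschmidt.exists_linearIndependent_condition hn ha hb hab
  · intro c _ hac hbc α
    exact Pfannschmidt.exists_condition_hermiteFun hn ha hac hbc α
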